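/- Let $m\ge 1$, let $T=T^m=U(1)^m$, and let $X$ be a locally standard $T$-pseudomanifold over a graph, i.e. a connected $(m+1)$-dimensional locally standard $T^m$-pseudomanifold with $l=0$ and $n=1$ in the sense recalled here. For $l\ge 0$ and $m\ge n\ge 0$, an $(l+m+n)$-dimensional locally standard $T^m$-pseudomanifold is a second countable compact Hausdorff space $X$ with a continuous effective $T^m$-action such that all isotropy groups $T_x$ are subtori; the filtration by orbit dimension $X_{l+2i+(m-n)}=X_{l+2i+1+(m-n)}=\{x\mid \dim T(x)\le i+(m-n)\}$ makes $X$ a topological stratified pseudomanifold; every orbit has dimension at least $m-n$; free orbits exist if $l+n\neq 0$; and, by induction on $l+n$: if $l=n=0$, $X$ is a finite disjoint union of copies of $T^m$ with the multiplication action; if $l+n\ne 0$, every $x\in X_{l+2i+(m-n)}\setminus X_{l+2(i-1)+(m-n)}$ has a $T$-invariant open neighbourhood that is weakly equivariantly homeomorphic to $O\times(\Omega\times U(1)^{m-n})\times \mathring c(L_x)$, where $O\subset\mathbb R^l$ is open and contractible, $\Omega\subset(\mathbb C^\times)^i$ is open and $U(1)^i$-invariant, $L_x$ is a $(2n-2i-1)$-dimensional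 locally standard $T_x$-pseudomanifold (empty if $i=n$), $\mathring c(L_x)$ is the open cone (a point if $L_x=\emptyset$), and $T^m\cong T^m/T_x\times T_x\cong U(1)^{i+(m-n)}\times T^{n-i}$ acts by multiplication on $\Omega\times U(1)^{m-n}$ and through the $T_x$-action on $L_x$ on the cone. Let $\pi:X\to Q=X/T$ be the orbit projection, and let $Q$ carry the induced filtration $Q_0\subset Q_1=Q$, where $Q_0$ is the image of the set of non-free orbits. The strata of $Q$ are the connected components of $Q_0$ and of $Q_1\setminus Q_0$; they are ordered by $S_1\le S_2$ iff $S_1\subset\overline{S_2}$. A characteristic functor on $Q$ is a functor $\lambda$ from the opposite of this ordered set to the category of subtori of $T$ and inclusions, such that $\dim\lambda(S)=1-\dim S$ for each stratum $S$. Then there is a characteristic functor $\lambda$ on $Q$ such that $\lambda(S)=T_x$ for every stratum $S$ and every $x\in\pi^{-1}(S)$, and for this $\lambda$ there are $T$-equivariant homeomorphisms $$X\;\cong\; Q\times T/{\sim_\lambda}\;\cong\; X(Q,\lambda,0).$$ Here $(p,t)\sim_\lambda(q,s)$ iff $p=q$ and $t^{-1}s\in\lambda(S)$ for the stratum $S$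 containing $p$. For a principal $T$-bundle $\xi:P_c\to Q$ with Chern class $c\in H^2(Q;\mathbb Z^m)$, the canonical model is $X(Q,\lambda,c)=P_c/{\sim_\lambda}$, where $x\sim_\lambda y$ iff $\xi(x)=\xi(y)$ and $x,y$ lie in the same $\lambda(S)$-orbit for the stratum $S$ containing $\xi(x)$, with the $T$-action induced from $P_c$. The second homeomorphism holds for every principal $T$-bundle $P_c$ over $Q$, in particular for $c=0$. -/

import Mathlib

open CategoryTheory

universe u v

/-- The compact torus `T^m = U(1)^m`. -/
abbrev Torus (m : ℕ) : Type := Fin m → Circle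

/-! ### Open cones -/

/-- The height of a point of `L × [0, 1)`, with height `0` for the extra point. -/
def OpenCone.preHeight {L : Type u} : (L × Set.Ico (0 : ℝ) 1) ⊕ Unit → ℝ
  | Sum.inl z => z.2
  | Sum.inr _ => 0

/-- The relation identifying all points of height `0`. -/
def OpenCone.setoid (L : Type u) : Setoid ((L × Set.Ico (0 : ℝ) 1) ⊕ Unit) where
  r a b := a = b ∨ (OpenCone.preHeight a = 0 ∧ OpenCone.preHeight b = 0)
  iseqv :=
    { refl := fun _ => Or.inl rfl
      symm := by
        rintro a b (h | h)
        · exact Or.inl h.symm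
        · exact Or.inr h.symm
      trans := by
        rintro a b c (rfl | h) (rfl | h')
        · exact Or.inl rfl
        · exact Or.inr h'
        · exact Or.inr h
        · exact Or.inr ⟨h.1, h'.2⟩ }

/-- The open cone `L × [0, 1) / L × {0}`. The extra point (glued to `L × {0}`, hence without effect
when `L` is non-empty) makes the open cone on the empty space a single point. -/
def OpenCone (L : Type u) : Type u := Quotient (OpenCone.setoid L)

instance (L : Type u) [TopologicalSpace L] : TopologicalSpace (OpenCone L) :=
  inferInstanceAs (TopologicalSpace (Quotient (OpenCone.setoid L)))

namespace OpenCone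

/-- The point `[v, r]` of the open cone. -/
def mk {L : Type u} (v : L) (r : Set.Ico (0 : ℝ) 1) : OpenCone L :=
  Quotient.mk (OpenCone.setoid L) (Sum.inl (v, r))

/-- The cone vertex. -/
def vertex (L : Type u) : OpenCone L := Quotient.mk (OpenCone.setoid L) (Sum.inr ())

/-- The subcone over a subset `A` of `L`; for `A = ∅` it consists of the vertex. -/
def subcone {L : Type u} (A : Set L) : Set (OpenCone L) :=
  {z | z = vertex L ∨ ∃ v ∈ A, ∃ r, z = mk v r}

/-- The map of open cones `[v, r] ↦ [f v, r]` induced by a map of the bases. -/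
def map {L : Type u} {L' : Type v} (f : L → L') : OpenCone L → OpenCone L' :=
  Quotient.map (sa := OpenCone.setoid L) (sb := OpenCone.setoid L')
    (Sum.map (fun z => (f z.1, z.2)) id) (by
      have key : ∀ c : (L × Set.Ico (0 : ℝ) 1) ⊕ Unit,
          preHeight (Sum.map (fun z : L × Set.Ico (0 : ℝ) 1 => (f z.1, z.2)) id c)
            = preHeight c := by
        rintro (c | c) <;> rfl
      rintro a b (h | ⟨h₁, h₂⟩)
      · exact Or.inl (by rw [h])
      · exact Or.inr ⟨(key a).trans h₁, (key b).trans h₂⟩)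

end OpenCone

/-! ### Topological stratified pseudomanifolds

A filtration is recorded as a family `F : ℤ → Set Q` of skeleta; `F k` is the `k`-skeleton. -/

/-- A filtered space with lowest skeleton dimension `l` and length `n`. -/
structure IsFilteredSpace (l n : ℕ) {Q : Type u} [TopologicalSpace Q] (F : ℤ → Set Q) : Prop where
  nonempty : Nonempty Q
  hausdorff : T2Space Q
  isClosed : ∀ k, IsClosed (F k)
  mono : Monotone F
  top_eq : F ((l : ℤ) + n) = Set.univ
  top_ne : F ((l : ℤ) + n - 1) ≠ Set.univ
  bot_nonempty : (F (l : ℤ)).Nonempty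
  below_bot : F ((l : ℤ) - 1) = ∅

/-- A stratum of dimension `dim`: a connected component of `F dim \ F (dim - 1)`. -/
structure Stratum {Q : Type u} [TopologicalSpace Q] (F : ℤ → Set Q) where
  dim : ℤ
  carrier : Set Q
  isComponent : ∃ p ∈ F dim \ F (dim - 1), carrier = connectedComponentIn (F dim \ F (dim - 1)) p

/-- A `k`-dimensional topological manifold: Hausdorff, second countable, locally Euclidean. -/
def IsTopologicalManifold (k : ℕ) (S : Type u) [TopologicalSpace S] : Prop :=
  T2Space S ∧ SecondCountableTopology S ∧ Nonempty (ChartedSpace (EuclideanSpace ℝ (Fin k)) S)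

/-- `(Q, F)` is an `(l + n)`-dimensional topological stratified pseudomanifold of length `n`.
A link of dimension `-1` is the empty space; a link of dimension `n - i - 1 ≥ 0` is a
pseudomanifold with some lowest dimension `l'` and length `n'` such that `l' + n' = n - i - 1`. -/
def IsStratifiedPseudomanifold (l n : ℕ) (Q : Type u) [TopologicalSpace Q] (F : ℤ → Set Q) : Prop :=
  IsFilteredSpace l n F ∧
  (l + n = 0 → DiscreteTopology Q) ∧
  (l + n ≠ 0 →
    (∀ i ≤ n, ∀ S : Stratum F, S.dim = (l : ℤ) + i → IsTopologicalManifold (l + i) S.carrier) ∧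
    Dense (F ((l : ℤ) + n) \ F ((l : ℤ) + n - 1)) ∧
    ∀ i ≤ n, ∀ p ∈ F ((l : ℤ) + i) \ F ((l : ℤ) + i - 1),
      ∃ (L : Type u) (_ : TopologicalSpace L) (G : ℤ → Set L),
        CompactSpace L ∧
        ((i = n ∧ IsEmpty L) ∨
          ∃ (l' n' : ℕ) (_ : l' + n' + 1 + i = n), IsStratifiedPseudomanifold l' n' L G) ∧
        ∃ (U : Set Q) (O : Set (EuclideanSpace ℝ (Fin (l + i)))) (φ : U ≃ₜ O × OpenCone L),
          IsOpen U ∧ p ∈ U ∧ IsOpen O ∧ ContractibleSpace O ∧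
          ∀ j : ℤ, -1 ≤ j → j ≤ (n : ℤ) - i - 1 →
            ∀ y : U, (y : Q) ∈ F ((l : ℤ) + i + j + 1) ↔ (φ y).2 ∈ OpenCone.subcone (G j))
termination_by l + n

/-! ### Locally standard torus pseudomanifolds -/

/-- A subtorus: a connected closed subgroup of the torus. -/
def IsSubtorus {m : ℕ} (H : Subgroup (Torus m)) : Prop :=
  IsClosed (H : Set (Torus m)) ∧ IsConnected (H : Set (Torus m))

/-- The dimension of a subtorus `H`: the number `k` such that `H` is isomorphic to `T^k`. -/
noncomputable def torusRank {m : ℕ} (H : Subgroup (Torus m)) : ℕ :=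
  sInf {k : ℕ | Nonempty (H ≃ₜ* Torus k)}

/-- The dimension of the orbit `T(x) ≅ T^m / T_x`. -/
noncomputable def orbitDim (m : ℕ) {X : Type u} [MulAction (Torus m) X] (x : X) : ℤ :=
  (m : ℤ) - torusRank (MulAction.stabilizer (Torus m) x)

/-- The filtration by orbit dimension: for `k = l + 2 i + (m - n)` and for
`k = l + 2 i + 1 + (m - n)`, the `k`-skeleton is `{x | dim T(x) ≤ i + (m - n)}`
(the division rounds down). -/
def orbitFiltration (l n m : ℕ) (X : Type u) [MulAction (Torus m) X] (k : ℤ) : Set X :=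
  {x | orbitDim m x ≤ (k - l - ((m : ℤ) - n)) / 2 + ((m : ℤ) - n)}

/-- `X` with its `T^m`-action is an `(l + m + n)`-dimensional locally standard
`T`-pseudomanifold. -/
def IsLocallyStandard (l n m : ℕ) (X : Type u) [TopologicalSpace X] [MulAction (Torus m) X] :
    Prop :=
  n ≤ m ∧ SecondCountableTopology X ∧ CompactSpace X ∧ T2Space X ∧
  ContinuousSMul (Torus m) X ∧ FaithfulSMul (Torus m) X ∧
  (∀ x : X, IsSubtorus (MulAction.stabilizer (Torus m) x)) ∧
  IsStratifiedPseudomanifold (l + (m - n)) (2 * n) X (orbitFiltration l n m X) ∧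
  (∀ x : X, (m : ℤ) - n ≤ orbitDim m x) ∧
  (l + n ≠ 0 → orbitFiltration l n m X ((l : ℤ) + m + n - 2) ≠ Set.univ) ∧
  (l + n = 0 →
    ∃ (c : ℕ) (e : X ≃ₜ Fin c × Torus m), ∀ (t : Torus m) (x : X),
      e (t • x) = ((e x).1, t * (e x).2)) ∧
  (l + n ≠ 0 →
    ∀ i ≤ n, ∀ x ∈ orbitFiltration l n m X ((l : ℤ) + 2 * i + ((m : ℤ) - n)) \
        orbitFiltration l n m X ((l : ℤ) + 2 * ((i : ℤ) - 1) + ((m : ℤ) - n)),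
      ∃ (L : Type u) (_ : TopologicalSpace L) (_ : MulAction (Torus (n - i)) L),
        ((i = n ∧ IsEmpty L) ∨
          ∃ (l' n' : ℕ) (_ : l' + n' + 1 + i = n), IsLocallyStandard l' n' (n - i) L) ∧
        ∃ (U : Set X) (hU : ∀ (t : Torus m), ∀ y ∈ U, t • y ∈ U)
          (O : Set (EuclideanSpace ℝ (Fin l))) (Ω : Set (Fin i → ℂ))
          (ψ : Torus m ≃ₜ* (Torus i × Torus (m - n)) × Torus (n - i))
          (φ : U ≃ₜ O × (Ω × Torus (m - n)) × OpenCone L),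
          IsOpen U ∧ x ∈ U ∧ IsOpen O ∧ ContractibleSpace O ∧
          IsOpen Ω ∧ (∀ w ∈ Ω, ∀ j, w j ≠ 0) ∧
          (∀ (s : Torus i), ∀ w ∈ Ω, (fun j => (s j : ℂ) * w j) ∈ Ω) ∧
          -- `ψ` is a splitting `T^m ≅ T^m / T_x × T_x` followed by isomorphisms of the factors
          (∀ t : Torus m, t ∈ MulAction.stabilizer (Torus m) x ↔ (ψ t).1 = 1) ∧
          -- `φ` is equivariant along `ψ`
          ∀ (t : Torus m) (y : U),
            (φ ⟨t • (y : X), hU t y y.2⟩).1 = (φ y).1 ∧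
            (((φ ⟨t • (y : X), hU t y y.2⟩).2.1.1 : Ω) : Fin i → ℂ) =
              (fun j => ((ψ t).1.1 j : ℂ) * ((φ y).2.1.1 : Fin i → ℂ) j) ∧
            (φ ⟨t • (y : X), hU t y y.2⟩).2.1.2 = (ψ t).1.2 * (φ y).2.1.2 ∧
            (φ ⟨t • (y : X), hU t y y.2⟩).2.2 =
              OpenCone.map (fun v => (ψ t).2 • v) (φ y).2.2)
termination_by l + n

/-- A locally standard `T^m`-pseudomanifold over a graph: a connected one with `l = 0`, `n = 1`. -/
def IsLocallyStandardOverGraph (m : ℕ) (X : Type u) [TopologicalSpace X] [MulAction (Torus m) X] :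
    Prop :=
  ConnectedSpace X ∧ IsLocallyStandard 0 1 m X

/-! ### Orbit spaces and characteristic functors -/

/-- The orbit space `Q = X / T^m`, with the quotient topology. -/
abbrev OrbitSpace (m : ℕ) (X : Type u) [MulAction (Torus m) X] : Type u :=
  Quotient (MulAction.orbitRel (Torus m) X)

/-- The orbit projection. -/
noncomputable def orbitProj (m : ℕ) {X : Type u} [MulAction (Torus m) X] (x : X) : OrbitSpace m X :=
  Quotient.mk (MulAction.orbitRel (Torus m) X) x

/-- The filtration of the orbit space: `Q_{l+i}` is the image of `X_{l+2i+(m-n)}`. -/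
def orbitSpaceFiltration (l n m : ℕ) (X : Type u) [MulAction (Torus m) X] (k : ℤ) :
    Set (OrbitSpace m X) :=
  orbitProj m '' orbitFiltration l n m X ((l : ℤ) + 2 * (k - l) + ((m : ℤ) - n))

/-- Strata are ordered by `S₁ ≤ S₂` if and only if `S₁` is contained in the closure of `S₂`. -/
instance {Q : Type u} [TopologicalSpace Q] (F : ℤ → Set Q) : Preorder (Stratum F) where
  le S₁ S₂ := S₁.carrier ⊆ closure S₂.carrier
  le_refl _ := subset_closure
  le_trans _ _ _ h₁ h₂ := h₁.trans (closure_minimal h₂ isClosed_closure)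

/-- The category (poset) of subtori of `T^m` with inclusions. -/
abbrev Subtorus (m : ℕ) : Type := {H : Subgroup (Torus m) // IsSubtorus H}

/-- A characteristic functor on a `d`-dimensional filtered space `(Q, F)`: a stratum of
codimension `i` is sent to a subtorus of dimension `i`. -/
structure CharacteristicFunctor (d m : ℕ) {Q : Type u} [TopologicalSpace Q] (F : ℤ → Set Q) where
  functor : (Stratum F)ᵒᵖ ⥤ Subtorus m
  rank_eq : ∀ S : Stratum F, (torusRank (functor.obj (Opposite.op S)).1 : ℤ) = (d : ℤ) - S.dim

/-- The subtorus attached to a stratum. -/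
def CharacteristicFunctor.subtorusAt {d m : ℕ} {Q : Type u} [TopologicalSpace Q] {F : ℤ → Set Q}
    (lam : CharacteristicFunctor d m F) (S : Stratum F) : Subgroup (Torus m) :=
  (lam.functor.obj (Opposite.op S)).1

/-- `lam` is the characteristic functor of `X`: it sends a stratum of `X / T` to the isotropy
subgroup of the points over it. -/
def IsCharacteristicFunctorOf (l n m : ℕ) (X : Type u) [TopologicalSpace X] [MulAction (Torus m) X]
    (lam : CharacteristicFunctor (l + n) m (orbitSpaceFiltration l n m X)) : Prop :=
  ∀ (x : X) (S : Stratum (orbitSpaceFiltration l n m X)), orbitProj m x ∈ S.carrier →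
    lam.subtorusAt S = MulAction.stabilizer (Torus m) x

/-! ### Canonical models -/

/-- A principal `T^m`-bundle over `Q`. -/
structure PrincipalTorusBundle (m : ℕ) (Q : Type u) [TopologicalSpace Q] where
  Total : Type v
  [topology : TopologicalSpace Total]
  [action : MulAction (Torus m) Total]
  [continuousSMul : ContinuousSMul (Torus m) Total]
  proj : Total → Q
  continuous_proj : Continuous proj
  proj_smul : ∀ (t : Torus m) (x : Total), proj (t • x) = proj x
  locally_trivial : ∀ q : Q, ∃ (U : Set Q) (φ : proj ⁻¹' U ≃ₜ U × Torus m),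
    IsOpen U ∧ q ∈ U ∧ (∀ x, ((φ x).1 : Q) = proj x) ∧
    ∀ (t : Torus m) (x y : proj ⁻¹' U), (y : Total) = t • (x : Total) → (φ y).2 = t * (φ x).2

attribute [instance] PrincipalTorusBundle.topology PrincipalTorusBundle.action
  PrincipalTorusBundle.continuousSMul

section Models

variable {d m : ℕ} {Q : Type u} [TopologicalSpace Q] {F : ℤ → Set Q}

/-- Two points of a principal bundle are identified if they lie over the same point `p` and in the
same orbit of the subtorus attached to the stratum containing `p`. -/
def CanonicalModel.setoid (lam : CharacteristicFunctor d m F)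
    (P : PrincipalTorusBundle.{u, v} m Q) : Setoid P.Total where
  r x y := P.proj x = P.proj y ∧
    ∀ S : Stratum F, P.proj x ∈ S.carrier → ∃ s ∈ lam.subtorusAt S, s • x = y
  iseqv :=
    { refl := fun x => ⟨rfl, fun S _ => ⟨1, one_mem _, one_smul _ x⟩⟩
      symm := by
        rintro x y ⟨h, hS⟩
        refine ⟨h.symm, fun S hy => ?_⟩
        obtain ⟨s, hs, rfl⟩ := hS S (h ▸ hy)
        exact ⟨s⁻¹, inv_mem hs, inv_smul_smul s x⟩
      trans := by
        rintro x y z ⟨h, hS⟩ ⟨h', hS'⟩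
        refine ⟨h.trans h', fun S hx => ?_⟩
        obtain ⟨s, hs, rfl⟩ := hS S hx
        obtain ⟨s', hs', rfl⟩ := hS' S (h ▸ hx)
        exact ⟨s' * s, mul_mem hs' hs, mul_smul s' s x⟩ }

/-- The canonical model `P / ∼` of a principal bundle `P` and a characteristic functor. -/
def CanonicalModel (lam : CharacteristicFunctor d m F) (P : PrincipalTorusBundle.{u, v} m Q) :
    Type v :=
  Quotient (CanonicalModel.setoid lam P)

instance (lam : CharacteristicFunctor d m F) (P : PrincipalTorusBundle.{u, v} m Q) :
    TopologicalSpace (CanonicalModel lam P) :=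
  inferInstanceAs (TopologicalSpace (Quotient (CanonicalModel.setoid lam P)))

/-- The action on the canonical model induced by the action on `P`. -/
instance (lam : CharacteristicFunctor d m F) (P : PrincipalTorusBundle.{u, v} m Q) :
    MulAction (Torus m) (CanonicalModel lam P) where
  smul t := Quotient.map (sa := CanonicalModel.setoid lam P) (sb := CanonicalModel.setoid lam P)
    (fun x => t • x) (by
      rintro x y ⟨h, hS⟩
      refine ⟨by rw [P.proj_smul, P.proj_smul, h], fun S hx => ?_⟩
      rw [P.proj_smul] at hx
      obtain ⟨s, hs, rfl⟩ := hS S hx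
      exact ⟨s, hs, smul_comm s t x⟩)
  one_smul := by
    rintro ⟨x⟩
    exact congrArg (Quotient.mk (CanonicalModel.setoid lam P)) (one_smul _ x)
  mul_smul := by
    rintro s t ⟨x⟩
    exact congrArg (Quotient.mk (CanonicalModel.setoid lam P)) (mul_smul s t x)

/-- The relation on `Q × T^m`: `(p, t) ∼ (q, s)` if `p = q` and `t⁻¹ s` lies in the subtorus
attached to the stratum containing `p`. -/
def ProductModel.setoid (lam : CharacteristicFunctor d m F) : Setoid (Q × Torus m) where
  r a b := a.1 = b.1 ∧ ∀ S : Stratum F, a.1 ∈ S.carrier → a.2⁻¹ * b.2 ∈ lam.subtorusAt S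
  iseqv :=
    { refl := fun a => ⟨rfl, fun S _ => by rw [inv_mul_cancel]; exact one_mem _⟩
      symm := by
        rintro a b ⟨h, hS⟩
        refine ⟨h.symm, fun S hb => ?_⟩
        have := inv_mem (hS S (h ▸ hb))
        rwa [mul_inv_rev, inv_inv] at this
      trans := by
        rintro a b c ⟨h, hS⟩ ⟨h', hS'⟩
        refine ⟨h.trans h', fun S ha => ?_⟩
        have := mul_mem (hS S ha) (hS' S (h ▸ ha))
        rwa [mul_assoc, mul_inv_cancel_left] at this }

/-- The space `Q × T^m / ∼`. -/
def ProductModel (lam : CharacteristicFunctor d m F) : Type u :=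
  Quotient (ProductModel.setoid lam)

instance (lam : CharacteristicFunctor d m F) : TopologicalSpace (ProductModel lam) :=
  inferInstanceAs (TopologicalSpace (Quotient (ProductModel.setoid lam)))

/-- The action on `Q × T^m / ∼` by multiplication on the second factor. -/
noncomputable instance (lam : CharacteristicFunctor d m F) : MulAction (Torus m) (ProductModel lam) where
  smul t := Quotient.map (sa := ProductModel.setoid lam) (sb := ProductModel.setoid lam)
    (fun a => (a.1, t * a.2)) (by
      rintro a b ⟨h, hS⟩
      refine ⟨h, fun S ha => ?_⟩
      have := hS S ha
      simpa [mul_inv_rev, mul_assoc] using this)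
  one_smul := by
    rintro ⟨a⟩
    exact congrArg (Quotient.mk (ProductModel.setoid lam)) (Prod.ext rfl (one_mul a.2))
  mul_smul := by
    rintro s t ⟨a⟩
    exact congrArg (Quotient.mk (ProductModel.setoid lam)) (Prod.ext rfl (mul_assoc s t a.2))

end Models

/-- Two `T^m`-spaces are equivariantly homeomorphic. -/
def EquivariantlyHomeomorphic (m : ℕ) (A : Type u) (B : Type v) [TopologicalSpace A]
    [TopologicalSpace B] [MulAction (Torus m) A] [MulAction (Torus m) B] : Prop :=
  ∃ e : A ≃ₜ B, ∀ (t : Torus m) (a : A), e (t • a) = t • e a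

/-!
Everything follows from the existence of continuous global sections over the orbit space `Q = X / T`.
A global section `s` of the orbit projection `X → Q` gives a continuous equivariant surjection
`Q × T → X`, `(q, t) ↦ t • s q`, whose fibres are the classes of `∼_λ`; as `Q × T` is compact and `X`
is Hausdorff, it induces a homeomorphism of the product model with `X`. A global section of a
principal bundle `P → Q` trivializes `P`, and the trivialization carries `∼_λ` on `Q × T` to the
relation defining the canonical model.

The two kinds of sections come from one statement, `exists_section_of_local`, which applies to any
orbit map `p : Y → Q` with local sections that is free away from a finite set `V` of vertices, where
`Q` is compact Hausdorff and `Q \ V` is locally an interval. Local sections near the points of `V`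
give a section over a closed neighbourhood of `V`. The rest of `Q` is covered by finitely many arcs,
and a section over any closed set extends across an arc (`IsSectionOn.exists_union_arc`): over the arc
`p` is a trivial bundle, so one has to extend a torus-valued map from a closed subset of `[a, b]` to
`[a, b]`. This is possible (`exists_torus_extension`) because such a map lifts to a vector-valued map,
to which the Tietze extension theorem applies. No classification of graphs or of one-dimensional
manifolds is needed.

The hypotheses on `Q` are read off from the standard charts. A chart around a non-free orbit is
`T^(m-1) × c(L)` with `L` a finite disjoint union of circles, and it has only one non-free orbit, the
one over the vertex; a chart around a free orbit is `Ω × T^(m-1)` with `Ω ⊂ ℂ \ {0}` invariant, and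
the modulus on `Ω` is a chart of `Q`. In both cases replacing the torus coordinates by `1` gives a
local section (`StandardChart.exists_isSectionOn`).

The characteristic functor sends a stratum to the isotropy group of any point over it. This is
well defined and order reversing because the isotropy is trivial on strata of free orbits, and the
other strata, being connected and finite, are single points.
-/

open Set Filter Topology

/-! ### Extending torus-valued maps from closed subsets of an interval -/

theorem ContinuousOn.exists_piecewise {Q : Type*} {Y : Type*} [TopologicalSpace Q]
    [TopologicalSpace Y] {C D : Set Q} {f g : Q → Y} (hC : IsClosed C) (hD : IsClosed D)
    (hf : ContinuousOn f C) (hg : ContinuousOn g D) (h : EqOn f g (C ∩ D)) :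
    ∃ k : Q → Y, ContinuousOn k (C ∪ D) ∧ EqOn k f C ∧ EqOn k g D := by
  classical
  have h₁ : EqOn (C.piecewise f g) f C := C.piecewise_eqOn f g
  have h₂ : EqOn (C.piecewise f g) g D := by
    intro q hq
    by_cases hqC : q ∈ C
    · rw [h₁ hqC, h ⟨hqC, hq⟩]
    · exact C.piecewise_eqOn_compl f g hqC
  exact ⟨_, (hf.congr h₁).union_of_isClosed (hg.congr h₂) hC hD, h₁, h₂⟩

/-- Near each point of `E`, a circle-valued map stays in an open half circle, where the argument
is continuous. -/
theorem exists_local_circle_lift {E : Set ℝ} (hE : IsClosed E) {g : ℝ → Circle}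
    (hg : ContinuousOn g E) (x : ℝ) :
    ∃ N, IsOpen N ∧ x ∈ N ∧ ∃ θ : ℝ → ℝ, ContinuousOn θ (E ∩ N) ∧
      ∀ z ∈ E ∩ N, Circle.exp (θ z) = g z := by
  by_cases hx : x ∈ E
  · have hdiv : ContinuousOn (fun z => (((g z) / (g x) : Circle) : ℂ)) E := by
      have : ContinuousOn (fun z => g z / g x) E := hg.div' continuousOn_const
      exact continuous_subtype_val.comp_continuousOn this
    have hmem : ∀ᶠ z in 𝓝[E] x, (((g z) / (g x) : Circle) : ℂ) ∈ Complex.slitPlane := by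
      refine (hdiv x hx).eventually (Complex.isOpen_slitPlane.mem_nhds ?_)
      simp
    obtain ⟨N, hN, hxN, hsub⟩ := mem_nhdsWithin.1 hmem
    refine ⟨N, hN, hxN, fun z => Complex.arg ((g z / g x : Circle) : ℂ) + Complex.arg (g x),
      ?_, ?_⟩
    · refine ContinuousOn.add ?_ continuousOn_const
      intro z hz
      exact ContinuousAt.comp_continuousWithinAt (g := Complex.arg)
        (f := fun z => ((g z / g x : Circle) : ℂ))
        (Complex.continuousAt_arg (hsub ⟨hz.2, hz.1⟩)) ((hdiv z hz.1).mono inter_subset_left)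
    · intro z _
      rw [Circle.exp_add, Circle.exp_arg, Circle.exp_arg, div_mul_cancel]
  · exact ⟨Eᶜ, hE.isOpen_compl, hx, fun _ => 0, continuousOn_const, fun z hz => (hz.2 hz.1).elim⟩

/-- Lifts over adjacent intervals agree at the common end point after a shift by a multiple of
`2π`. -/
theorem exists_circle_lift_trans {E : Set ℝ} (hE : IsClosed E) {g : ℝ → Circle} {a b c : ℝ}
    (hab : a ≤ b) (hbc : b ≤ c)
    (h₁ : ∃ θ : ℝ → ℝ, ContinuousOn θ (E ∩ Icc a b) ∧ ∀ z ∈ E ∩ Icc a b, Circle.exp (θ z) = g z)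
    (h₂ : ∃ θ : ℝ → ℝ, ContinuousOn θ (E ∩ Icc b c) ∧ ∀ z ∈ E ∩ Icc b c, Circle.exp (θ z) = g z) :
    ∃ θ : ℝ → ℝ, ContinuousOn θ (E ∩ Icc a c) ∧ ∀ z ∈ E ∩ Icc a c, Circle.exp (θ z) = g z := by
  obtain ⟨θ₁, hc₁, he₁⟩ := h₁
  obtain ⟨θ₂, hc₂, he₂⟩ := h₂
  obtain ⟨δ, hδ, hδb⟩ : ∃ δ : ℝ, Circle.exp δ = 1 ∧ (b ∈ E → θ₁ b = θ₂ b + δ) := by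
    by_cases hb : b ∈ E
    · refine ⟨θ₁ b - θ₂ b, ?_, fun _ => by ring⟩
      rw [Circle.exp_sub, he₁ b ⟨hb, right_mem_Icc.2 hab⟩, he₂ b ⟨hb, left_mem_Icc.2 hbc⟩, div_self']
    · exact ⟨0, Circle.exp_zero, fun h => (hb h).elim⟩
  obtain ⟨θ, hθ, hθ₁, hθ₂⟩ := ContinuousOn.exists_piecewise (hE.inter isClosed_Icc)
    (hE.inter isClosed_Icc) hc₁ (hc₂.add (continuousOn_const (c := δ))) (by
      rintro z ⟨⟨hzE, hz₁⟩, -, hz₂⟩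
      obtain rfl : z = b := le_antisymm hz₁.2 hz₂.1
      exact hδb hzE)
  rw [← inter_union_distrib_left, Icc_union_Icc_eq_Icc hab hbc] at hθ
  refine ⟨θ, hθ, fun z hz => ?_⟩
  rcases le_total z b with h | h
  · have hz' : z ∈ E ∩ Icc a b := ⟨hz.1, hz.2.1, h⟩
    rw [hθ₁ hz', he₁ z hz']
  · have hz' : z ∈ E ∩ Icc b c := ⟨hz.1, h, hz.2.2⟩
    rw [hθ₂ hz', Pi.add_apply, Circle.exp_add, hδ, mul_one, he₂ z hz']

theorem exists_circle_lift {E : Set ℝ} (hE : IsClosed E) {g : ℝ → Circle}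
    (hg : ContinuousOn g E) {a b : ℝ} (hab : a ≤ b) :
    ∃ θ : ℝ → ℝ, ContinuousOn θ (E ∩ Icc a b) ∧ ∀ z ∈ E ∩ Icc a b, Circle.exp (θ z) = g z := by
  choose N hN hxN hlift using exists_local_circle_lift hE hg
  obtain ⟨t, ht0, htm, ⟨n, hn⟩, hsub⟩ := exists_monotone_Icc_subset_open_cover_Icc hab
    (c := fun x : ℝ => ((↑) : Icc a b → ℝ) ⁻¹' N x) (fun x => (hN x).preimage continuous_subtype_val)
    (fun x _ => mem_iUnion.2 ⟨x, hxN x⟩)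
  have key : ∀ k : ℕ, ∃ θ : ℝ → ℝ, ContinuousOn θ (E ∩ Icc a (t k)) ∧
      ∀ z ∈ E ∩ Icc a (t k : ℝ), Circle.exp (θ z) = g z := by
    have step : ∀ k : ℕ, ∃ θ : ℝ → ℝ, ContinuousOn θ (E ∩ Icc (t k : ℝ) (t (k + 1))) ∧
        ∀ z ∈ E ∩ Icc (t k : ℝ) (t (k + 1)), Circle.exp (θ z) = g z := by
      intro k
      obtain ⟨x, hx⟩ := hsub k
      have hx' : Icc (t k : ℝ) (t (k + 1)) ⊆ N x := fun z hz =>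
        hx (a := ⟨z, (t k).2.1.trans hz.1, hz.2.trans (t (k + 1)).2.2⟩) ⟨hz.1, hz.2⟩
      obtain ⟨θ, hθ, he⟩ := hlift x
      exact ⟨θ, hθ.mono (inter_subset_inter_right _ hx'),
        fun z hz => he z (inter_subset_inter_right _ hx' hz)⟩
    intro k
    induction k with
    | zero =>
      refine ⟨fun _ => Complex.arg (g a), continuousOn_const, fun z hz => ?_⟩
      obtain rfl : z = a := le_antisymm (hz.2.2.trans_eq ht0) hz.2.1
      exact Circle.exp_arg _
    | succ k ih =>
      exact exists_circle_lift_trans hE (t k).2.1 (htm k.le_succ) ih (step k)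
  simpa only [hn n le_rfl] using key n

/-- A torus-valued map on a closed subset of an interval extends to the interval: it lifts to a
vector-valued map, to which the Tietze extension theorem applies. -/
theorem exists_torus_extension {m : ℕ} {E : Set ℝ} (hE : IsClosed E) {g : ℝ → Torus m}
    (hg : ContinuousOn g E) {a b : ℝ} (hab : a ≤ b) :
    ∃ h : ℝ → Torus m, Continuous h ∧ EqOn h g (E ∩ Icc a b) := by
  have key : ∀ j : Fin m, ∃ h : ℝ → Circle, Continuous h ∧ EqOn h (fun z => g z j) (E ∩ Icc a b) := by
    intro j
    obtain ⟨θ, hθ, he⟩ := exists_circle_lift hE (continuousOn_pi.1 hg j) hab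
    obtain ⟨Θ, hΘ⟩ := ContinuousMap.exists_restrict_eq (hE.inter (isClosed_Icc (a := a) (b := b)))
      ⟨_, hθ.domRestrict⟩
    refine ⟨fun z => Circle.exp (Θ z), Circle.exp.continuous.comp Θ.continuous, fun z hz => ?_⟩
    have : Θ z = θ z := DFunLike.congr_fun hΘ ⟨z, hz⟩
    simp only [this, he z hz]
  choose h hc he using key
  exact ⟨fun z j => h j z, continuous_pi hc, fun z hz => funext fun j => he j hz⟩

/-! ### Global sections over graphs -/

/-- `s` restricts to a continuous section of `p` over `C`; its values off `C` are irrelevant. -/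
structure IsSectionOn {Q : Type*} {Y : Type*} [TopologicalSpace Q] [TopologicalSpace Y]
    (p : Y → Q) (C : Set Q) (s : Q → Y) : Prop where
  continuousOn : ContinuousOn s C
  proj_eq : ∀ q ∈ C, p (s q) = q

namespace IsSectionOn

variable {Q : Type*} {Y : Type*} [TopologicalSpace Q] [TopologicalSpace Y] {p : Y → Q}
  {C D : Set Q} {s τ : Q → Y}

theorem mono (hs : IsSectionOn p C s) (h : D ⊆ C) : IsSectionOn p D s :=
  ⟨hs.continuousOn.mono h, fun q hq => hs.proj_eq q (h hq)⟩

theorem exists_union (hC : IsClosed C) (hD : IsClosed D) (hs : IsSectionOn p C s)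
    (hτ : IsSectionOn p D τ) (h : EqOn s τ (C ∩ D)) : ∃ σ, IsSectionOn p (C ∪ D) σ := by
  obtain ⟨k, hk, h₁, h₂⟩ := hs.continuousOn.exists_piecewise hC hD hτ.continuousOn h
  refine ⟨k, hk, ?_⟩
  rintro q (hq | hq)
  · rw [h₁ hq, hs.proj_eq q hq]
  · rw [h₂ hq, hτ.proj_eq q hq]

/-- Over a compact set where the action is free, two sections of an orbit map differ by a
continuous torus-valued function. -/
theorem exists_continuousOn_smul_eq {m : ℕ} [MulAction (Torus m) Y] [ContinuousSMul (Torus m) Y]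
    [T2Space Y] (hps : ∀ (t : Torus m) (y : Y), p (t • y) = p y)
    (hpo : ∀ y y', p y = p y' → ∃ t : Torus m, t • y = y')
    (hfree : ∀ y, p y ∈ D → ∀ t : Torus m, t • y = y → t = 1)
    (hD : IsCompact D) (hτ : IsSectionOn p D τ) (hs : IsSectionOn p C s) (hCD : C ⊆ D) :
    ∃ g : Q → Torus m, ContinuousOn g C ∧ ∀ q ∈ C, g q • τ q = s q := by
  have : CompactSpace D := isCompact_iff_compactSpace.1 hD
  -- `F` is a closed embedding, so the torus coordinate depends continuously on the point of `Y`
  let F : Torus m × D → Y := fun x => x.1 • τ x.2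
  have hF : Continuous F :=
    continuous_fst.smul (hτ.continuousOn.domRestrict.comp continuous_snd)
  have hFi : Function.Injective F := by
    rintro ⟨t, q⟩ ⟨t', q'⟩ h
    have hq : q = q' := by
      have := congrArg p h
      simp only [F, hps, hτ.proj_eq _ q.2, hτ.proj_eq _ q'.2] at this
      exact Subtype.ext this
    subst hq
    have h1 : (t'⁻¹ * t) • τ q = τ q := by
      rw [mul_smul]; exact inv_smul_eq_iff.2 h
    have := hfree _ (by rw [hτ.proj_eq _ q.2]; exact q.2) _ h1
    rw [inv_mul_eq_one.1 this]
  have hFe := hF.isClosedEmbedding hFi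
  have hex : ∀ q ∈ C, ∃ t : Torus m, t • τ q = s q := fun q hq =>
    hpo _ _ (by rw [hτ.proj_eq q (hCD hq), hs.proj_eq q hq])
  classical
  let g : Q → Torus m := fun q => if hq : q ∈ C then (hex q hq).choose else 1
  have hg : ∀ q ∈ C, g q • τ q = s q := fun q hq => by
    simp only [g, dif_pos hq]; exact (hex q hq).choose_spec
  refine ⟨g, ?_, hg⟩
  rw [continuousOn_iff_continuous_domRestrict]
  have h2 : Continuous (fun q : C => ((g q, ⟨q, hCD q.2⟩) : Torus m × D)) := by
    rw [hFe.isInducing.continuous_iff]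
    refine hs.continuousOn.domRestrict.congr fun q => ?_
    exact (hg q q.2).symm
  exact continuous_fst.comp h2

/-- A section over a closed set `C` extends across an arc `e.symm '' [a, b]` over which the action
is free and some section exists. -/
theorem exists_union_arc {m : ℕ} [MulAction (Torus m) Y] [ContinuousSMul (Torus m) Y]
    [T2Space Y] [T2Space Q] (hps : ∀ (t : Torus m) (y : Y), p (t • y) = p y)
    (hpo : ∀ y y', p y = p y' → ∃ t : Torus m, t • y = y')
    (e : OpenPartialHomeomorph Q ℝ) {a b : ℝ} (hab : a ≤ b) (he : Icc a b ⊆ e.target)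
    (hfree : ∀ y, p y ∈ e.symm '' Icc a b → ∀ t : Torus m, t • y = y → t = 1)
    (hτ : IsSectionOn p (e.symm '' Icc a b) τ) (hC : IsClosed C) (hs : IsSectionOn p C s) :
    ∃ σ, IsSectionOn p (C ∪ e.symm '' Icc a b) σ := by
  set D := e.symm '' Icc a b with hD
  have hec : ContinuousOn e.symm (Icc a b) := e.continuousOn_symm.mono he
  have hDc : IsCompact D := isCompact_Icc.image_of_continuousOn hec
  have hDs : D ⊆ e.source := by
    rintro _ ⟨r, hr, rfl⟩; exact e.map_target (he hr)
  have heD : ∀ q ∈ D, e q ∈ Icc a b ∧ e.symm (e q) = q := by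
    rintro _ ⟨r, hr, rfl⟩
    rw [e.right_inv (he hr)]; exact ⟨hr, rfl⟩
  obtain ⟨g, hgc, hg⟩ := exists_continuousOn_smul_eq hps hpo hfree hDc hτ
    (hs.mono (inter_subset_left (t := D))) inter_subset_right
  -- the part of the arc where a section is prescribed, in the coordinate `e`
  have hE : IsClosed (Icc a b ∩ e.symm ⁻¹' C) := hec.preimage_isClosed_of_isClosed isClosed_Icc hC
  have hgE : ContinuousOn (fun r => g (e.symm r)) (Icc a b ∩ e.symm ⁻¹' C) :=
    hgc.comp (hec.mono inter_subset_left) fun r hr => ⟨hr.2, mem_image_of_mem _ hr.1⟩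
  obtain ⟨h, hh, heq⟩ := exists_torus_extension hE hgE hab
  refine hs.exists_union hC hDc.isClosed (τ := fun q => h (e q) • τ q) ⟨?_, ?_⟩ ?_
  · exact (hh.comp_continuousOn (e.continuousOn.mono hDs)).smul hτ.continuousOn
  · intro q hq
    rw [hps, hτ.proj_eq q hq]
  · rintro q ⟨hqC, hqD⟩
    obtain ⟨h1, h2⟩ := heD q hqD
    have h3 := heq (x := e q) ⟨⟨h1, by rwa [mem_preimage, h2]⟩, h1⟩
    simp only [h2] at h3
    simp only [h3, hg q ⟨hqC, hqD⟩]

/-- Local sections over neighbourhoods of finitely many points can be taken over disjoint closed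
neighbourhoods, so they form a section over a neighbourhood of the finite set. -/
theorem exists_nhds_finite [T2Space Q] [RegularSpace Q] [Nonempty Y]
    (hloc : ∀ q, ∃ N ∈ 𝓝 q, ∃ s, IsSectionOn p N s) {V : Set Q} (hV : V.Finite) :
    ∃ W, IsClosed W ∧ V ⊆ interior W ∧ ∃ s, IsSectionOn p W s := by
  suffices h : ∀ A : Set Q, A.Finite → A ⊆ V →
      ∃ W, IsClosed W ∧ A ⊆ interior W ∧ Disjoint W (V \ A) ∧ ∃ s, IsSectionOn p W s by
    obtain ⟨W, h1, h2, -, h3⟩ := h V hV subset_rfl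
    exact ⟨W, h1, h2, h3⟩
  intro A hA
  induction A, hA using Set.Finite.induction_on with
  | empty =>
    intro _
    exact ⟨∅, isClosed_empty, empty_subset _, disjoint_bot_left, fun _ => Classical.arbitrary Y,
      continuousOn_empty _, fun q hq => hq.elim⟩
  | @insert v A hvA hA ih =>
    intro hsub
    obtain ⟨W, hWc, hAW, hWV, s, hs⟩ := ih ((subset_insert v A).trans hsub)
    obtain ⟨N, hN, τ, hτ⟩ := hloc v
    have hvW : v ∉ W := fun h => hWV.le_bot ⟨h, hsub (mem_insert v A), hvA⟩
    have hO : N ∩ Wᶜ ∩ (V \ {v})ᶜ ∈ 𝓝 v :=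
      inter_mem (inter_mem hN (hWc.isOpen_compl.mem_nhds hvW))
        ((hV.subset sdiff_subset).isClosed.isOpen_compl.mem_nhds fun h => h.2 rfl)
    obtain ⟨D, hD, hDc, hDs⟩ := exists_mem_nhds_isClosed_subset hO
    obtain ⟨σ, hσ⟩ := hs.exists_union hWc hDc (hτ.mono fun q hq => (hDs hq).1.1)
      fun q hq => ((hDs hq.2).1.2 hq.1).elim
    refine ⟨W ∪ D, hWc.union hDc, ?_, ?_, σ, hσ⟩
    · rintro q (rfl | hq)
      · exact interior_mono subset_union_right (mem_interior_iff_mem_nhds.2 hD)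
      · exact interior_mono subset_union_left (hAW hq)
    · rw [disjoint_left]
      rintro q (hq | hq) ⟨hqV, hqA⟩
      · exact hWV.le_bot ⟨hq, hqV, fun h => hqA (mem_insert_of_mem _ h)⟩
      · exact (hDs hq).2 ⟨hqV, fun h => hqA (h ▸ mem_insert _ _)⟩

end IsSectionOn

/-- If `Q` is compact and locally an open interval away from a finite set `V`, then an orbit map
`p : Y → Q` of a torus action that is free over `Q \ V` has a global section as soon as it has
local ones. -/
theorem exists_section_of_local {m : ℕ} {Q : Type*} {Y : Type*} [TopologicalSpace Q]
    [TopologicalSpace Y] [CompactSpace Q] [T2Space Q] [T2Space Y] [Nonempty Y]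
    [MulAction (Torus m) Y] [ContinuousSMul (Torus m) Y] {p : Y → Q}
    (hps : ∀ (t : Torus m) (y : Y), p (t • y) = p y)
    (hpo : ∀ y y', p y = p y' → ∃ t : Torus m, t • y = y')
    (hloc : ∀ q, ∃ N ∈ 𝓝 q, ∃ s, IsSectionOn p N s) {V : Set Q} (hV : V.Finite)
    (hfree : ∀ y, p y ∉ V → ∀ t : Torus m, t • y = y → t = 1)
    (harc : ∀ q ∉ V, ∃ e : OpenPartialHomeomorph Q ℝ, q ∈ e.source) :
    ∃ s : Q → Y, Continuous s ∧ ∀ q, p (s q) = q := by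
  obtain ⟨W, hWc, hVW, hW⟩ := IsSectionOn.exists_nhds_finite hloc hV
  -- the property "a section over any closed `C` yields one over `C ∪ D`" is stable under unions in
  -- `D`, without any agreement between the old and the new section
  have key : ∃ D, (interior W)ᶜ ⊆ D ∧ IsClosed D ∧
      ∀ C, IsClosed C → (∃ s, IsSectionOn p C s) → ∃ s, IsSectionOn p (C ∪ D) s := by
    refine isOpen_interior.isClosed_compl.isCompact.induction_on
      (p := fun K => ∃ D, K ⊆ D ∧ IsClosed D ∧
        ∀ C, IsClosed C → (∃ s, IsSectionOn p C s) → ∃ s, IsSectionOn p (C ∪ D) s) ?_ ?_ ?_ ?_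
    · exact ⟨∅, subset_rfl, isClosed_empty, fun C _ hs => by rwa [union_empty]⟩
    · rintro K K' h ⟨D, hD, h'⟩
      exact ⟨D, h.trans hD, h'⟩
    · rintro K K' ⟨D, hD, hDc, h⟩ ⟨D', hD', hDc', h'⟩
      refine ⟨D ∪ D', union_subset_union hD hD', hDc.union hDc', fun C hC hs => ?_⟩
      rw [← union_assoc]
      exact h' _ (hC.union hDc) (h C hC hs)
    · intro q hq
      have hqV : q ∉ V := fun h => hq (hVW h)
      obtain ⟨e, he⟩ := harc q hqV
      obtain ⟨N, hN, τ, hτ⟩ := hloc q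
      have hNV : e.target ∩ e.symm ⁻¹' (N ∩ Vᶜ) ∈ 𝓝 (e q) := by
        refine inter_mem (e.open_target.mem_nhds (e.map_source he)) ?_
        refine (e.continuousAt_symm (e.map_source he)).preimage_mem_nhds ?_
        rw [e.left_inv he]
        exact inter_mem hN (hV.isClosed.isOpen_compl.mem_nhds hqV)
      obtain ⟨a, b, hmem, hab, hsub⟩ := exists_Icc_mem_subset_of_mem_nhds hNV
      refine ⟨e.symm '' Icc a b, mem_nhdsWithin_of_mem_nhds ?_, e.symm '' Icc a b, subset_rfl, ?_, ?_⟩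
      · rw [← e.left_inv he]
        exact e.symm.image_mem_nhds (e.map_source he) hab
      · exact (isCompact_Icc.image_of_continuousOn
          (e.continuousOn_symm.mono fun r hr => (hsub hr).1)).isClosed
      · rintro C hC ⟨s, hs⟩
        refine IsSectionOn.exists_union_arc hps hpo e (hmem.1.trans hmem.2) (fun r hr => (hsub hr).1) ?_
          (hτ.mono ?_) hC hs
        · rintro y ⟨r, hr, hy⟩
          exact hfree y (hy ▸ (hsub hr).2.2)
        · rintro _ ⟨r, hr, rfl⟩
          exact (hsub hr).2.1
  obtain ⟨D, hD, -, hext⟩ := key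
  obtain ⟨s, hs⟩ := hext W hWc hW
  have huniv : ∀ q, q ∈ W ∪ D := fun q => by
    by_cases hq : q ∈ interior W
    · exact Or.inl (interior_subset hq)
    · exact Or.inr (hD hq)
  exact ⟨s, continuousOn_univ.1 (hs.continuousOn.mono fun q _ => huniv q),
    fun q => hs.proj_eq q (huniv q)⟩

/-! ### Open cones -/

namespace OpenCone

variable {L : Type*} {L' : Type*} {L'' : Type*}

theorem map_comp (f : L → L') (g : L' → L'') (z : OpenCone L) :
    map g (map f z) = map (fun v => g (f v)) z := by
  rcases z with ⟨z | z⟩ <;> rfl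

theorem continuous_map [TopologicalSpace L] [TopologicalSpace L'] {f : L → L'}
    (hf : Continuous f) : Continuous (map f) := by
  refine Continuous.quotient_map' (s := OpenCone.setoid L) (t := OpenCone.setoid L') ?_ _
  exact ((hf.comp continuous_fst).prodMk continuous_snd).sumMap continuous_id

theorem eq_vertex_or (z : OpenCone L) :
    z = vertex L ∨ ∃ (v : L) (r : Set.Ico (0 : ℝ) 1), (r : ℝ) ≠ 0 ∧ z = mk v r := by
  rcases z with ⟨⟨v, r⟩ | z⟩
  · by_cases hr : (r : ℝ) = 0
    · exact Or.inl (Quotient.sound (s := OpenCone.setoid L) (Or.inr ⟨hr, rfl⟩))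
    · exact Or.inr ⟨v, r, hr, rfl⟩
  · exact Or.inl rfl

theorem mk_inj {v v' : L} {r : Set.Ico (0 : ℝ) 1} (hr : (r : ℝ) ≠ 0) (h : mk v r = mk v' r) :
    v = v' := by
  rcases Quotient.exact (s := OpenCone.setoid L) h with h | h
  · exact congrArg Prod.fst (Sum.inl_injective h)
  · exact (hr h.1).elim

instance [IsEmpty L] : Subsingleton (OpenCone L) :=
  ⟨fun z z' => by
    rcases eq_vertex_or z with rfl | ⟨v, -⟩
    · rcases eq_vertex_or z' with rfl | ⟨v, -⟩
      · rfl
      · exact isEmptyElim v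
    · exact isEmptyElim v⟩

/-- A map that moves each point of `L` within its orbit does the same on the open cone. -/
theorem exists_map_smul_eq {G : Type*} [Group G] [MulAction G L] {f : L → L}
    (hf : ∀ v, ∃ s : G, f v = s • v) (z : OpenCone L) :
    ∃ s : G, map f z = map (fun v => s • v) z := by
  rcases z with ⟨⟨v, r⟩ | z⟩
  · obtain ⟨s, hs⟩ := hf v
    exact ⟨s, congrArg (fun a => mk a r) hs⟩
  · exact ⟨1, rfl⟩

end OpenCone

/-! ### The orbit projection -/

section OrbitProj

variable {m : ℕ} {X : Type u} [MulAction (Torus m) X]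

theorem orbitProj_eq_iff {x y : X} : orbitProj m x = orbitProj m y ↔ ∃ t : Torus m, t • x = y := by
  rw [eq_comm]
  exact Quotient.eq (r := MulAction.orbitRel (Torus m) X)

theorem orbitProj_smul (t : Torus m) (x : X) : orbitProj m (t • x) = orbitProj m x :=
  (orbitProj_eq_iff.2 ⟨t, rfl⟩).symm

theorem orbitProj_surjective : Function.Surjective (orbitProj m (X := X)) := Quotient.mk_surjective

theorem stabilizer_eq_of_orbitProj_eq {x y : X} (h : orbitProj m x = orbitProj m y) :
    MulAction.stabilizer (Torus m) x = MulAction.stabilizer (Torus m) y := by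
  obtain ⟨t, rfl⟩ := orbitProj_eq_iff.1 h
  ext s
  rw [MulAction.mem_stabilizer_iff, MulAction.mem_stabilizer_iff, smul_comm, smul_left_cancel_iff]

variable [TopologicalSpace X]

theorem continuous_orbitProj : Continuous (orbitProj m (X := X)) := continuous_quotient_mk'

variable [ContinuousSMul (Torus m) X]

theorem isOpenMap_orbitProj : IsOpenMap (orbitProj m (X := X)) :=
  isOpenMap_quotient_mk'_mul

theorem t2Space_orbitSpace [CompactSpace X] [T2Space X] : T2Space (OrbitSpace m X) :=
  have : ProperSMul (Torus m) X :=
    ⟨Continuous.isProperMap (continuous_smul.prodMk continuous_snd)⟩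
  t2Space_quotient_mulAction_of_properSMul

/-- A continuous invariant map on an open set descends to the image in the orbit space. -/
theorem exists_continuousOn_orbitSpace {Z : Type*} [TopologicalSpace Z] [Nonempty Z] {U : Set X}
    (hU : IsOpen U) {f : U → Z} (hf : Continuous f)
    (hinv : ∀ y y' : U, orbitProj m (y : X) = orbitProj m (y' : X) → f y = f y') :
    ∃ g : OrbitSpace m X → Z, ContinuousOn g (orbitProj m '' U) ∧
      ∀ y : U, g (orbitProj m (y : X)) = f y := by
  classical
  let g : OrbitSpace m X → Z := fun q =>
    if h : ∃ y : U, orbitProj m (y : X) = q then f h.choose else Classical.arbitrary Z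
  have hg : ∀ y : U, g (orbitProj m (y : X)) = f y := by
    intro y
    have h : ∃ y' : U, orbitProj m (y' : X) = orbitProj m (y : X) := ⟨y, rfl⟩
    simp only [g, dif_pos h]
    exact hinv _ _ h.choose_spec
  refine ⟨g, ?_, hg⟩
  rintro _ ⟨y, hy, rfl⟩
  refine ContinuousAt.continuousWithinAt fun S hS => ?_
  rw [hg ⟨y, hy⟩] at hS
  have h1 := ((isOpenMap_orbitProj (m := m)).comp hU.isOpenMap_subtype_val).image_mem_nhds
    (hf.continuousAt.preimage_mem_nhds hS)
  refine mem_map.2 (mem_of_superset h1 ?_)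
  rintro _ ⟨y', hy', rfl⟩
  exact mem_preimage.2 ((hg y').symm ▸ mem_preimage.1 hy' : g (orbitProj m (y' : X)) ∈ S)

end OrbitProj

/-! ### Standard charts -/

theorem exists_circle_mul_eq_norm {w w' : ℂ} (h : ‖w‖ = ‖w'‖) (hw : w ≠ 0) :
    ∃ u : Circle, (u : ℂ) * w = w' := by
  refine ⟨⟨w' / w, ?_⟩, div_mul_cancel₀ _ hw⟩
  refine mem_sphere_zero_iff_norm.2 ?_
  rw [norm_div, h, div_self]
  rw [← h]
  exact norm_ne_zero_iff.2 hw

/-- The local model of a locally standard torus pseudomanifold: an invariant open subset of `X`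
identified with `O × (Ω × T^k) × c(L)`, equivariantly along a splitting `T^m ≅ (T^i × T^k) × T^j`.
The set `Ω ⊂ (ℂ \ {0})^i` is open and invariant. A chart has no distinguished point, and `O` is not
required to be open or contractible. -/
structure StandardChart (d m i k j : ℕ) (X : Type u) (L : Type v) [TopologicalSpace X]
    [MulAction (Torus m) X] [TopologicalSpace L] [MulAction (Torus j) L] where
  U : Set X
  smul_mem : ∀ (t : Torus m), ∀ y ∈ U, t • y ∈ U
  O : Set (EuclideanSpace ℝ (Fin d))
  Ω : Set (Fin i → ℂ)
  ψ : Torus m ≃ₜ* (Torus i × Torus k) × Torus j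
  φ : U ≃ₜ O × (Ω × Torus k) × OpenCone L
  isOpen_U : IsOpen U
  isOpen_Ω : IsOpen Ω
  ne_zero : ∀ w ∈ Ω, ∀ l, w l ≠ 0
  smul_mem_Ω : ∀ (s : Torus i), ∀ w ∈ Ω, (fun l => (s l : ℂ) * w l) ∈ Ω
  map_smul : ∀ (t : Torus m) (y : U),
    (φ ⟨t • (y : X), smul_mem t y y.2⟩).1 = (φ y).1 ∧
    (((φ ⟨t • (y : X), smul_mem t y y.2⟩).2.1.1 : Ω) : Fin i → ℂ) =
      (fun l => ((ψ t).1.1 l : ℂ) * ((φ y).2.1.1 : Fin i → ℂ) l) ∧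
    (φ ⟨t • (y : X), smul_mem t y y.2⟩).2.1.2 = (ψ t).1.2 * (φ y).2.1.2 ∧
    (φ ⟨t • (y : X), smul_mem t y y.2⟩).2.2 = OpenCone.map (fun v => (ψ t).2 • v) (φ y).2.2

namespace StandardChart

variable {d m i k j : ℕ} {X : Type u} {L : Type v} [TopologicalSpace X]
  [MulAction (Torus m) X] [TopologicalSpace L] [MulAction (Torus j) L]
  (C : StandardChart d m i k j X L)

theorem mem_stabilizer_iff (y : C.U) (t : Torus m) :
    t ∈ MulAction.stabilizer (Torus m) (y : X) ↔
      (C.ψ t).1 = 1 ∧ OpenCone.map (fun v => (C.ψ t).2 • v) (C.φ y).2.2 = (C.φ y).2.2 := by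
  obtain ⟨h1, h2, h3, h4⟩ := C.map_smul t y
  rw [MulAction.mem_stabilizer_iff]
  constructor
  · intro h
    have h' : (⟨t • (y : X), C.smul_mem t y y.2⟩ : C.U) = y := Subtype.ext h
    rw [h'] at h2 h3 h4
    refine ⟨Prod.ext (funext fun l => ?_) (mul_eq_right.1 h3.symm), h4.symm⟩
    refine Circle.ext ?_
    exact mul_right_cancel₀ (C.ne_zero _ (C.φ y).2.1.1.2 l)
      (by rw [← congrFun h2 l]; simp)
  · rintro ⟨h, h'⟩
    have : (⟨t • (y : X), C.smul_mem t y y.2⟩ : C.U) = y := by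
      refine C.φ.injective (Prod.ext h1 (Prod.ext (Prod.ext (Subtype.ext ?_) ?_) (h4.trans h')))
      · rw [h2, h]; simp
      · rw [h3, h]; simp
    exact congrArg Subtype.val this

theorem orbitProj_eq_iff (y y' : C.U) : orbitProj m (y : X) = orbitProj m (y' : X) ↔
    (C.φ y).1 = (C.φ y').1 ∧
    (∀ l, ‖((C.φ y).2.1.1 : Fin i → ℂ) l‖ = ‖((C.φ y').2.1.1 : Fin i → ℂ) l‖) ∧
    ∃ s : Torus j, OpenCone.map (fun v => s • v) (C.φ y).2.2 = (C.φ y').2.2 := by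
  rw [_root_.orbitProj_eq_iff]
  constructor
  · rintro ⟨t, ht⟩
    obtain ⟨h1, h2, -, h4⟩ := C.map_smul t y
    have h' : (⟨t • (y : X), C.smul_mem t y y.2⟩ : C.U) = y' := Subtype.ext ht
    rw [h'] at h1 h2 h4
    refine ⟨h1.symm, fun l => ?_, _, h4.symm⟩
    rw [h2, norm_mul, Circle.norm_coe, one_mul]
  · rintro ⟨h, hn, s, hs⟩
    choose a ha using fun l => exists_circle_mul_eq_norm (hn l) (C.ne_zero _ (C.φ y).2.1.1.2 l)
    let t := C.ψ.symm ((a, (C.φ y').2.1.2 * ((C.φ y).2.1.2)⁻¹), s)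
    have ht : C.ψ t = ((a, (C.φ y').2.1.2 * ((C.φ y).2.1.2)⁻¹), s) := C.ψ.apply_symm_apply _
    obtain ⟨h1, h2, h3, h4⟩ := C.map_smul t y
    rw [ht] at h2 h3 h4
    refine ⟨t, ?_⟩
    have : (⟨t • (y : X), C.smul_mem t y y.2⟩ : C.U) = y' := by
      refine C.φ.injective (Prod.ext (h1.trans h)
        (Prod.ext (Prod.ext (Subtype.ext ?_) ?_) (h4.trans hs)))
      · rw [h2]; exact funext ha
      · rw [h3]; exact inv_mul_cancel_right _ _
    exact congrArg Subtype.val this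

theorem norm_mem_Ω {w : Fin i → ℂ} (hw : w ∈ C.Ω) : (fun l => ((‖w l‖ : ℝ) : ℂ)) ∈ C.Ω := by
  choose a ha using fun l => exists_circle_mul_eq_norm (w := w l) (w' := ((‖w l‖ : ℝ) : ℂ))
    (by simp) (C.ne_zero _ hw l)
  have := C.smul_mem_Ω a w hw
  rwa [funext ha] at this

/-- A section of the link over its orbit space, given as an invariant map `f` that moves points
within their orbits, induces the local section `(o, (w, t), z) ↦ (o, (|w|, 1), c(f)(z))`. -/
theorem exists_isSectionOn [ContinuousSMul (Torus m) X] {f : L → L} (hf : Continuous f)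
    (hinv : ∀ (s : Torus j) (v : L), f (s • v) = f v) (horb : ∀ v, ∃ s : Torus j, f v = s • v) {x : X}
    (hx : x ∈ C.U) : ∃ N ∈ 𝓝 (orbitProj m x), ∃ s, IsSectionOn (orbitProj m) N s := by
  -- `σ` is constant on orbits and moves points within them, so it descends to a local section
  let σ : C.U → C.U := fun y => C.φ.symm ((C.φ y).1,
    (⟨fun l => ((‖((C.φ y).2.1.1 : Fin i → ℂ) l‖ : ℝ) : ℂ), C.norm_mem_Ω (C.φ y).2.1.1.2⟩, 1),
    OpenCone.map f (C.φ y).2.2)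
  have hσ : Continuous σ := by
    refine C.φ.symm.continuous.comp ?_
    have h1 : Continuous fun y => (C.φ y).2.1.1 := by fun_prop
    have h2 : Continuous fun y => (C.φ y).2.2 := by fun_prop
    refine (by fun_prop : Continuous fun y => (C.φ y).1).prodMk
      (Continuous.prodMk (Continuous.prodMk (Continuous.subtype_mk ?_ _) continuous_const)
        ((OpenCone.continuous_map hf).comp h2))
    exact continuous_pi fun l => Complex.continuous_ofReal.comp
      ((continuous_apply l).comp (continuous_subtype_val.comp h1)).norm
  have hσφ : ∀ y, C.φ (σ y) = _ := fun y => C.φ.apply_symm_apply _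
  have hσo : ∀ y, orbitProj m (σ y : X) = orbitProj m (y : X) := by
    intro y
    refine ((C.orbitProj_eq_iff y (σ y)).2 ?_).symm
    rw [hσφ]
    refine ⟨rfl, fun l => by simp, ?_⟩
    obtain ⟨s, hs⟩ := OpenCone.exists_map_smul_eq horb (C.φ y).2.2
    exact ⟨s, hs.symm⟩
  have hσi : ∀ y y' : C.U, orbitProj m (y : X) = orbitProj m (y' : X) →
      (σ y : X) = (σ y' : X) := by
    intro y y' h
    obtain ⟨h1, h2, s, hs⟩ := (C.orbitProj_eq_iff y y').1 h
    have : σ y = σ y' := by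
      refine C.φ.injective ?_
      rw [hσφ, hσφ, ← hs, OpenCone.map_comp]
      simp only [h1, h2, hinv]
    exact congrArg Subtype.val this
  have : Nonempty X := ⟨x⟩
  obtain ⟨g, hg, hgσ⟩ := exists_continuousOn_orbitSpace C.isOpen_U
    (continuous_subtype_val.comp hσ) hσi
  refine ⟨orbitProj m '' C.U, isOpenMap_orbitProj.image_mem_nhds (C.isOpen_U.mem_nhds hx), g, hg, ?_⟩
  rintro _ ⟨y, hy, rfl⟩
  rw [hgσ ⟨y, hy⟩]
  exact hσo ⟨y, hy⟩

end StandardChart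

/-- Around a free orbit, the modulus of the coordinate in `Ω ⊂ ℂ \ {0}` is a chart of the orbit
space. -/
theorem StandardChart.exists_openPartialHomeomorph {m k j : ℕ} {X : Type u} {L : Type v}
    [TopologicalSpace X] [MulAction (Torus m) X] [TopologicalSpace L] [MulAction (Torus j) L]
    [ContinuousSMul (Torus m) X] [IsEmpty L] (C : StandardChart 0 m 1 k j X L) {x : X}
    (hx : x ∈ C.U) :
    ∃ e : OpenPartialHomeomorph (OrbitSpace m X) ℝ, orbitProj m x ∈ e.source := by
  classical
  have hρ : Continuous fun y : C.U => ‖((C.φ y).2.1.1 : Fin 1 → ℂ) 0‖ := by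
    have h1 : Continuous fun y => (C.φ y).2.1.1 := by fun_prop
    exact ((continuous_apply 0).comp (continuous_subtype_val.comp h1)).norm
  obtain ⟨g, hg, hgρ⟩ := exists_continuousOn_orbitSpace C.isOpen_U hρ fun y y' h =>
    ((C.orbitProj_eq_iff y y').1 h).2.1 0
  let R : Set ℝ := Ioi 0 ∩ (fun (r : ℝ) (_ : Fin 1) => (r : ℂ)) ⁻¹' C.Ω
  have hR : IsOpen R := isOpen_Ioi.inter
    (C.isOpen_Ω.preimage (continuous_pi fun _ => Complex.continuous_ofReal))
  let y₀ : R → C.U := fun r => C.φ.symm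
    ((C.φ ⟨x, hx⟩).1, (⟨fun _ => ((r : ℝ) : ℂ), r.2.2⟩, 1), OpenCone.vertex L)
  have hy₀ : Continuous y₀ := by
    refine C.φ.symm.continuous.comp ?_
    refine continuous_const.prodMk (Continuous.prodMk (Continuous.prodMk
      (Continuous.subtype_mk ?_ _) continuous_const) continuous_const)
    exact continuous_pi fun _ => Complex.continuous_ofReal.comp continuous_subtype_val
  have hy₀φ : ∀ r, C.φ (y₀ r) = _ := fun r => C.φ.apply_symm_apply _
  have hgy₀ : ∀ r : R, g (orbitProj m (y₀ r : X)) = r := by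
    intro r
    rw [hgρ, hy₀φ]
    simpa using le_of_lt r.2.1
  let c : ℝ → OrbitSpace m X := fun r =>
    if hr : r ∈ R then orbitProj m (y₀ ⟨r, hr⟩ : X) else orbitProj m x
  have hc : ∀ r : R, c r = orbitProj m (y₀ r : X) := fun r => dif_pos r.2
  have hgR : ∀ y : C.U, g (orbitProj m (y : X)) ∈ R := by
    intro y
    rw [hgρ]
    have h := C.norm_mem_Ω (C.φ y).2.1.1.2
    refine ⟨norm_pos_iff.2 (C.ne_zero _ (C.φ y).2.1.1.2 0), ?_⟩
    rw [mem_preimage]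
    convert h using 2 with l
    rw [Subsingleton.elim l 0]
  refine ⟨{ toFun := g
            invFun := c
            source := orbitProj m '' C.U
            target := R
            map_source' := ?_
            map_target' := ?_
            left_inv' := ?_
            right_inv' := ?_
            open_source := isOpenMap_orbitProj _ C.isOpen_U
            open_target := hR
            continuousOn_toFun := hg
            continuousOn_invFun := ?_ }, mem_image_of_mem _ hx⟩
  · rintro _ ⟨y, hy, rfl⟩
    exact hgR ⟨y, hy⟩
  · intro r hr
    rw [hc ⟨r, hr⟩]
    exact mem_image_of_mem _ (y₀ ⟨r, hr⟩).2
  · rintro _ ⟨y, hy, rfl⟩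
    rw [hc ⟨_, hgR ⟨y, hy⟩⟩]
    refine (C.orbitProj_eq_iff _ ⟨y, hy⟩).2 ?_
    rw [hy₀φ]
    refine ⟨Subsingleton.elim _ _, fun l => ?_, 1, Subsingleton.elim _ _⟩
    simp [hgρ ⟨y, hy⟩, Subsingleton.elim l 0]
  · intro r hr
    rw [hc ⟨r, hr⟩, hgy₀]
  · rw [continuousOn_iff_continuous_domRestrict]
    refine (continuous_orbitProj.comp (continuous_subtype_val.comp hy₀)).congr fun r => ?_
    exact (hc r).symm

/-! ### Torus pseudomanifolds over a graph -/

theorem torusRank_bot (m : ℕ) : torusRank (⊥ : Subgroup (Torus m)) = 0 := by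
  refine Nat.sInf_eq_zero.2 (Or.inl ⟨{ toFun := 1
                                       invFun := 1
                                       left_inv := fun _ => Subsingleton.elim _ _
                                       right_inv := fun _ => Subsingleton.elim _ _
                                       map_mul' := fun _ _ => Subsingleton.elim _ _
                                       continuous_toFun := continuous_const
                                       continuous_invFun := continuous_const }⟩)

namespace IsLocallyStandardOverGraph

variable {m : ℕ} {X : Type u} [TopologicalSpace X] [MulAction (Torus m) X]

theorem continuousSMul (hX : IsLocallyStandardOverGraph m X) : ContinuousSMul (Torus m) X := by
  have h := hX.2
  rw [IsLocallyStandard] at h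
  exact h.2.2.2.2.1

theorem compactSpace (hX : IsLocallyStandardOverGraph m X) : CompactSpace X := by
  have h := hX.2
  rw [IsLocallyStandard] at h
  exact h.2.2.1

theorem t2Space (hX : IsLocallyStandardOverGraph m X) : T2Space X := by
  have h := hX.2
  rw [IsLocallyStandard] at h
  exact h.2.2.2.1

theorem isSubtorus_stabilizer (hX : IsLocallyStandardOverGraph m X) (x : X) :
    IsSubtorus (MulAction.stabilizer (Torus m) x) := by
  have h := hX.2
  rw [IsLocallyStandard] at h
  exact h.2.2.2.2.2.2.1 x

/-- Around a point of a singular orbit, `X` is a product of an orbit and the open cone on finitely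
many circles. -/
theorem exists_chart_singular (hX : IsLocallyStandardOverGraph m X) {x : X}
    (hx : orbitDim m x ≤ m - 1) :
    ∃ (L : Type u) (_ : TopologicalSpace L) (_ : MulAction (Torus 1) L) (c : ℕ)
      (e : L ≃ₜ Fin c × Torus 1) (C : StandardChart 0 m 0 (m - 1) 1 X L),
      (∀ (t : Torus 1) (v : L), e (t • v) = ((e v).1, t * (e v).2)) ∧ x ∈ C.U := by
  have h := hX.2
  rw [IsLocallyStandard] at h
  obtain ⟨-, -, -, -, -, -, -, -, hlow, -, -, hchart⟩ := h
  have hlow := hlow x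
  obtain ⟨L, tL, aL, hL, U, hU, O, Ω, ψ, φ, hUo, hxU, -, -, hΩ, hΩ0, hΩs, -, hφ⟩ :=
    hchart (by norm_num) 0 (by norm_num) x (by
      simp only [orbitFiltration, Set.mem_sdiff, mem_ofPred_eq]
      push_cast at hlow ⊢
      omega)
  rcases hL with ⟨h, -⟩ | ⟨l', n', hl, hL⟩
  · omega
  · -- the link has `l' = n' = 0`, so it is a finite disjoint union of circles
    obtain ⟨rfl, rfl⟩ : l' = 0 ∧ n' = 0 := by omega
    rw [IsLocallyStandard] at hL
    obtain ⟨-, -, -, -, -, -, -, -, -, -, hL, -⟩ := hL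
    obtain ⟨c, e, he⟩ := hL rfl
    exact ⟨L, tL, aL, c, e, ⟨U, hU, O, Ω, ψ, φ, hUo, hΩ, hΩ0, hΩs, hφ⟩, he, hxU⟩

theorem exists_chart_free (hX : IsLocallyStandardOverGraph m X) {x : X}
    (hx : (m : ℤ) - 1 < orbitDim m x) :
    ∃ (L : Type u) (_ : TopologicalSpace L) (_ : MulAction (Torus 0) L) (_ : IsEmpty L)
      (C : StandardChart 0 m 1 (m - 1) 0 X L), x ∈ C.U := by
  have h := hX.2
  rw [IsLocallyStandard] at h
  obtain ⟨-, -, -, -, -, -, -, -, -, -, -, hchart⟩ := h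
  obtain ⟨L, tL, aL, hL, U, hU, O, Ω, ψ, φ, hUo, hxU, -, -, hΩ, hΩ0, hΩs, -, hφ⟩ :=
    hchart (by norm_num) 1 le_rfl x (by
      have : orbitDim m x ≤ m := by unfold orbitDim; omega
      simp only [orbitFiltration, Set.mem_sdiff, mem_ofPred_eq]
      push_cast
      omega)
  rcases hL with ⟨-, hL⟩ | ⟨l', n', hl, -⟩
  · exact ⟨L, tL, aL, hL, ⟨U, hU, O, Ω, ψ, φ, hUo, hΩ, hΩ0, hΩs, hφ⟩, hxU⟩
  · omega

end IsLocallyStandardOverGraph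

theorem StandardChart.stabilizer_eq_bot {d m i k : ℕ} {X : Type u} {L : Type v}
    [TopologicalSpace X] [MulAction (Torus m) X] [TopologicalSpace L] [MulAction (Torus 0) L]
    (C : StandardChart d m i k 0 X L) {x : X} (hx : x ∈ C.U) :
    MulAction.stabilizer (Torus m) x = ⊥ := by
  rw [eq_bot_iff]
  intro t ht
  have h := ((C.mem_stabilizer_iff ⟨x, hx⟩ t).1 ht).1
  exact C.ψ.injective ((Prod.ext h (Subsingleton.elim _ _)).trans (map_one C.ψ).symm)

/-- Where the torus acts freely on the link, all singular points of a chart lie over the vertex of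
the cone. -/
theorem StandardChart.eq_vertex {d m i k j : ℕ} {X : Type u} {L : Type v}
    [TopologicalSpace X] [MulAction (Torus m) X] [TopologicalSpace L] [MulAction (Torus j) L]
    (C : StandardChart d m i k j X L) (hfree : ∀ (s : Torus j) (v : L), s • v = v → s = 1)
    (y : C.U) (hy : MulAction.stabilizer (Torus m) (y : X) ≠ ⊥) :
    (C.φ y).2.2 = OpenCone.vertex L := by
  rcases OpenCone.eq_vertex_or (C.φ y).2.2 with h | ⟨v, r, hr, h⟩
  · exact h
  · refine (hy (eq_bot_iff.2 fun t ht => ?_)).elim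
    obtain ⟨h1, h2⟩ := (C.mem_stabilizer_iff y t).1 ht
    rw [h] at h2
    have h3 := hfree _ _ (OpenCone.mk_inj hr h2)
    exact C.ψ.injective ((Prod.ext h1 h3).trans (map_one C.ψ).symm)

/-- The singular part of the orbit space: the image of the non-free orbits. -/
def singularOrbits (m : ℕ) (X : Type u) [MulAction (Torus m) X] : Set (OrbitSpace m X) :=
  orbitProj m '' {x | MulAction.stabilizer (Torus m) x ≠ ⊥}

theorem orbitProj_mem_singularOrbits_iff {m : ℕ} {X : Type u} [MulAction (Torus m) X] {x : X} :
    orbitProj m x ∈ singularOrbits m X ↔ MulAction.stabilizer (Torus m) x ≠ ⊥ := by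
  refine ⟨?_, fun h => ⟨x, h, rfl⟩⟩
  rintro ⟨y, hy, h⟩
  rwa [← stabilizer_eq_of_orbitProj_eq h]

/-- The points of the orbit space of filtration dimension exactly `k` are the orbits of dimension
`k + (m - 1)`. -/
theorem orbitProj_mem_filtration_diff_iff {m : ℕ} {X : Type u} [MulAction (Torus m) X] {x : X}
    {k : ℤ} :
    orbitProj m x ∈ orbitSpaceFiltration 0 1 m X k \ orbitSpaceFiltration 0 1 m X (k - 1) ↔
      orbitDim m x = k + (m - 1) := by
  have key : ∀ k : ℤ, orbitProj m x ∈ orbitSpaceFiltration 0 1 m X k ↔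
      orbitDim m x ≤ k + (m - 1) := by
    intro k
    constructor
    · rintro ⟨y, hy, h⟩
      have hxy : orbitDim m x = orbitDim m y := by
        rw [orbitDim, orbitDim, stabilizer_eq_of_orbitProj_eq h]
      simp only [orbitFiltration, mem_ofPred_eq] at hy
      push_cast at hy
      omega
    · intro h
      refine ⟨x, ?_, rfl⟩
      simp only [orbitFiltration, mem_ofPred_eq]
      push_cast
      omega
  rw [Set.mem_sdiff, key, key]
  omega

namespace IsLocallyStandardOverGraph

variable {m : ℕ} {X : Type u} [TopologicalSpace X] [MulAction (Torus m) X]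

theorem orbitDim_cases (hX : IsLocallyStandardOverGraph m X) (x : X) :
    (orbitDim m x = m - 1 ∧ MulAction.stabilizer (Torus m) x ≠ ⊥) ∨
      (orbitDim m x = m ∧ MulAction.stabilizer (Torus m) x = ⊥) := by
  have h := hX.2
  rw [IsLocallyStandard] at h
  have hlow := h.2.2.2.2.2.2.2.2.1 x
  push_cast at hlow
  have hle : orbitDim m x ≤ m := by unfold orbitDim; omega
  by_cases hx : orbitDim m x ≤ m - 1
  · refine Or.inl ⟨by omega, fun hbot => ?_⟩
    -- the trivial stabilizer has rank `0`, which would make the orbit `m`-dimensional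
    rw [orbitDim, hbot, torusRank_bot] at hx
    omega
  · obtain ⟨L, tL, aL, -, C, hxC⟩ := hX.exists_chart_free (not_le.1 hx)
    exact Or.inr ⟨by omega, C.stabilizer_eq_bot hxC⟩

theorem exists_isSectionOn (hX : IsLocallyStandardOverGraph m X) (q : OrbitSpace m X) :
    ∃ N ∈ 𝓝 q, ∃ s, IsSectionOn (orbitProj m (X := X)) N s := by
  have := hX.continuousSMul
  obtain ⟨x, rfl⟩ := orbitProj_surjective q
  by_cases hx : orbitDim m x ≤ m - 1
  · obtain ⟨L, tL, aL, c, e, C, he, hxC⟩ := hX.exists_chart_singular hx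
    refine C.exists_isSectionOn (f := fun v => e.symm ((e v).1, 1)) ?_ ?_ ?_ hxC
    · exact e.symm.continuous.comp ((continuous_fst.comp e.continuous).prodMk continuous_const)
    · intro s v
      rw [he]
    · intro v
      refine ⟨(e v).2⁻¹, e.injective ?_⟩
      rw [he, e.apply_symm_apply, inv_mul_cancel]
  · obtain ⟨L, tL, aL, hL, C, hxC⟩ := hX.exists_chart_free (not_le.1 hx)
    exact C.exists_isSectionOn (f := id) continuous_id (fun _ v => isEmptyElim v)
      (fun v => isEmptyElim v) hxC

theorem exists_openPartialHomeomorph (hX : IsLocallyStandardOverGraph m X) {q : OrbitSpace m X}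
    (hq : q ∉ singularOrbits m X) : ∃ e : OpenPartialHomeomorph (OrbitSpace m X) ℝ, q ∈ e.source := by
  have := hX.continuousSMul
  obtain ⟨x, rfl⟩ := orbitProj_surjective q
  rw [orbitProj_mem_singularOrbits_iff] at hq
  have hx : (m : ℤ) - 1 < orbitDim m x := by
    rcases hX.orbitDim_cases x with h | h
    · exact (hq h.2).elim
    · omega
  obtain ⟨L, tL, aL, hL, C, hxC⟩ := hX.exists_chart_free hx
  exact C.exists_openPartialHomeomorph hxC

/-- Each chart contains at most one singular orbit, and finitely many charts cover `X`. -/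
theorem finite_singularOrbits (hX : IsLocallyStandardOverGraph m X) :
    (singularOrbits m X).Finite := by
  have := hX.continuousSMul
  have := hX.compactSpace
  rw [← inter_univ (singularOrbits m X)]
  refine (isCompact_univ (X := OrbitSpace m X)).induction_on
    (p := fun K => (singularOrbits m X ∩ K).Finite) ?_ ?_ ?_ ?_
  · simp
  · exact fun K K' h hf => hf.subset (inter_subset_inter_right _ h)
  · intro K K' h h'
    rw [inter_union_distrib_left]
    exact h.union h'
  · intro q _
    obtain ⟨x, rfl⟩ := orbitProj_surjective q
    by_cases hx : orbitDim m x ≤ m - 1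
    · obtain ⟨L, tL, aL, c, e, C, he, hxC⟩ := hX.exists_chart_singular hx
      have hfree : ∀ (s : Torus 1) (v : L), s • v = v → s = 1 := fun s v h => by
        have h1 := congrArg (fun v => (e v).2) h
        simp only [he] at h1
        exact mul_eq_right.1 h1
      refine ⟨orbitProj m '' C.U, mem_nhdsWithin_of_mem_nhds
        (isOpenMap_orbitProj.image_mem_nhds (C.isOpen_U.mem_nhds hxC)), ?_⟩
      refine Set.Subsingleton.finite ?_
      rintro _ ⟨h, y, hy, rfl⟩ _ ⟨h', y', hy', rfl⟩
      rw [orbitProj_mem_singularOrbits_iff] at h h'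
      refine (C.orbitProj_eq_iff ⟨y, hy⟩ ⟨y', hy'⟩).2
        ⟨Subsingleton.elim _ _, fun l => l.elim0, 1, ?_⟩
      rw [C.eq_vertex hfree ⟨y, hy⟩ h, C.eq_vertex hfree ⟨y', hy'⟩ h']
      rfl
    · obtain ⟨L, tL, aL, hL, C, hxC⟩ := hX.exists_chart_free (not_le.1 hx)
      refine ⟨orbitProj m '' C.U, mem_nhdsWithin_of_mem_nhds
        (isOpenMap_orbitProj.image_mem_nhds (C.isOpen_U.mem_nhds hxC)), ?_⟩
      convert finite_empty
      rw [← disjoint_iff_inter_eq_empty, disjoint_right]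
      rintro _ ⟨y, hy, rfl⟩ h
      exact orbitProj_mem_singularOrbits_iff.1 h (C.stabilizer_eq_bot hy)

/-! ### The characteristic functor -/

theorem orbitDim_of_mem_stratum {x : X} {S : Stratum (orbitSpaceFiltration 0 1 m X)}
    (hx : orbitProj m x ∈ S.carrier) : orbitDim m x = S.dim + (m - 1) := by
  obtain ⟨p, -, hS⟩ := S.isComponent
  exact orbitProj_mem_filtration_diff_iff.1 (connectedComponentIn_subset _ p (hS ▸ hx))

theorem exists_orbitProj_mem_stratum (S : Stratum (orbitSpaceFiltration 0 1 m X)) :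
    ∃ x : X, orbitProj m x ∈ S.carrier := by
  obtain ⟨p, hp, hS⟩ := S.isComponent
  obtain ⟨x, rfl⟩ := orbitProj_surjective p
  exact ⟨x, hS ▸ mem_connectedComponentIn hp⟩

theorem exists_stratum (x : X) :
    ∃ S : Stratum (orbitSpaceFiltration 0 1 m X), orbitProj m x ∈ S.carrier := by
  have h : orbitProj m x ∈ orbitSpaceFiltration 0 1 m X (orbitDim m x - (m - 1)) \
      orbitSpaceFiltration 0 1 m X (orbitDim m x - (m - 1) - 1) :=
    orbitProj_mem_filtration_diff_iff.2 (by ring)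
  exact ⟨⟨_, _, _, h, rfl⟩, mem_connectedComponentIn h⟩

theorem stratum_subset_singularOrbits (hX : IsLocallyStandardOverGraph m X)
    {S : Stratum (orbitSpaceFiltration 0 1 m X)} {x : X} (hx : orbitProj m x ∈ S.carrier)
    (hs : MulAction.stabilizer (Torus m) x ≠ ⊥) : S.carrier ⊆ singularOrbits m X := by
  intro q hq
  obtain ⟨y, rfl⟩ := orbitProj_surjective q
  have h1 := orbitDim_of_mem_stratum hx
  have h2 := orbitDim_of_mem_stratum hq
  rw [orbitProj_mem_singularOrbits_iff]
  rcases hX.orbitDim_cases x with h | h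
  · rcases hX.orbitDim_cases y with h' | h'
    · exact h'.2
    · omega
  · exact (hs h.2).elim

/-- A point in the closure of a stratum has isotropy at least that of the stratum: a stratum of
singular orbits is a single point, as it is connected and finite. -/
theorem stabilizer_le_of_mem_closure (hX : IsLocallyStandardOverGraph m X)
    {S : Stratum (orbitSpaceFiltration 0 1 m X)} {x y : X} (hx : orbitProj m x ∈ S.carrier)
    (hy : orbitProj m y ∈ closure S.carrier) :
    MulAction.stabilizer (Torus m) x ≤ MulAction.stabilizer (Torus m) y := by
  have := hX.continuousSMul
  have := hX.compactSpace
  have := hX.t2Space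
  have := t2Space_orbitSpace (m := m) (X := X)
  by_cases hs : MulAction.stabilizer (Torus m) x = ⊥
  · rw [hs]
    exact bot_le
  · have hfin := hX.finite_singularOrbits.subset (hX.stratum_subset_singularOrbits hx hs)
    rw [hfin.isClosed.closure_eq] at hy
    obtain ⟨p, -, hS⟩ := S.isComponent
    have hconn : IsPreconnected S.carrier := hS ▸ isPreconnected_connectedComponentIn
    have hsub : S.carrier.Subsingleton := by
      by_contra h
      exact hconn.infinite_of_nontrivial (not_subsingleton_iff.1 h) hfin
    exact (stabilizer_eq_of_orbitProj_eq (hsub hx hy)).le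

theorem exists_characteristicFunctor (hX : IsLocallyStandardOverGraph m X) :
    ∃ lam : CharacteristicFunctor (0 + 1) m (orbitSpaceFiltration 0 1 m X),
      IsCharacteristicFunctorOf 0 1 m X lam := by
  choose pt hpt using exists_orbitProj_mem_stratum (m := m) (X := X)
  refine ⟨{ functor :=
              { obj := fun S => ⟨MulAction.stabilizer (Torus m) (pt S.unop),
                  hX.isSubtorus_stabilizer _⟩
                map := fun {S S'} f => homOfLE
                  (hX.stabilizer_le_of_mem_closure (hpt S.unop) (f.unop.le (hpt S'.unop)))
                map_id := fun _ => Subsingleton.elim _ _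
                map_comp := fun _ _ => Subsingleton.elim _ _ }
            rank_eq := ?_ }, ?_⟩
  · intro S
    have h := orbitDim_of_mem_stratum (hpt S)
    change ((torusRank (MulAction.stabilizer (Torus m) (pt S)) : ℕ) : ℤ) = _
    rw [orbitDim] at h
    push_cast
    linarith
  · intro x S hx
    exact le_antisymm (hX.stabilizer_le_of_mem_closure (hpt S) (subset_closure hx))
      (hX.stabilizer_le_of_mem_closure hx (subset_closure (hpt S)))

end IsLocallyStandardOverGraph

/-! ### Principal torus bundles -/

namespace PrincipalTorusBundle

variable {m : ℕ} {Q : Type u} [TopologicalSpace Q] (P : PrincipalTorusBundle.{u, v} m Q)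

theorem t2Space [T2Space Q] : T2Space P.Total := by
  refine ⟨fun x y hxy => ?_⟩
  by_cases h : P.proj x = P.proj y
  · obtain ⟨U, φ, hU, hx, -, -⟩ := P.locally_trivial (P.proj x)
    have : T2Space (P.proj ⁻¹' U) := φ.isEmbedding.t2Space
    have hV := hU.preimage P.continuous_proj
    obtain ⟨A, B, hA, hB, hxA, hyB, hAB⟩ := t2_separation
      (x := (⟨x, hx⟩ : P.proj ⁻¹' U)) (y := ⟨y, mem_preimage.2 (h ▸ hx)⟩)
      (fun h => hxy (congrArg Subtype.val h))
    exact ⟨_, _, hV.isOpenMap_subtype_val A hA, hV.isOpenMap_subtype_val B hB,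
      ⟨_, hxA, rfl⟩, ⟨_, hyB, rfl⟩, (disjoint_image_iff Subtype.val_injective).2 hAB⟩
  · obtain ⟨A, B, hA, hB, hxA, hyB, hAB⟩ := t2_separation h
    exact ⟨_, _, hA.preimage P.continuous_proj, hB.preimage P.continuous_proj, hxA, hyB,
      hAB.preimage _⟩

theorem exists_smul_eq (x y : P.Total) (h : P.proj x = P.proj y) :
    ∃ t : Torus m, t • x = y := by
  obtain ⟨U, φ, -, hx, hφ, hφs⟩ := P.locally_trivial (P.proj x)
  have hy : y ∈ P.proj ⁻¹' U := mem_preimage.2 (h ▸ hx)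
  let t : Torus m := (φ ⟨y, hy⟩).2 * (φ ⟨x, hx⟩).2⁻¹
  have htx : t • x ∈ P.proj ⁻¹' U := by rw [mem_preimage, P.proj_smul]; exact hx
  have : (⟨t • x, htx⟩ : P.proj ⁻¹' U) = ⟨y, hy⟩ := by
    refine φ.injective (Prod.ext (Subtype.ext ?_) ?_)
    · rw [hφ, hφ, P.proj_smul, h]
    · rw [hφs t ⟨x, hx⟩ ⟨t • x, htx⟩ rfl]
      exact inv_mul_cancel_right _ _
  exact ⟨t, congrArg Subtype.val this⟩

theorem eq_one_of_smul_eq (x : P.Total) (t : Torus m) (h : t • x = x) : t = 1 := by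
  obtain ⟨U, φ, -, hx, -, hφs⟩ := P.locally_trivial (P.proj x)
  exact mul_eq_right.1 (hφs t ⟨x, hx⟩ ⟨x, hx⟩ h.symm).symm

theorem exists_isSectionOn (q : Q) : ∃ N ∈ 𝓝 q, ∃ s, IsSectionOn P.proj N s := by
  classical
  obtain ⟨U, φ, hU, hq, hφ, -⟩ := P.locally_trivial q
  let s : Q → P.Total := fun p => if hp : p ∈ U then (φ.symm (⟨p, hp⟩, 1) : P.Total) else
    (φ.symm (⟨q, hq⟩, 1) : P.Total)
  have hs : ∀ p : U, s p = φ.symm (p, 1) := fun p => dif_pos p.2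
  refine ⟨U, hU.mem_nhds hq, s, ?_, fun p hp => ?_⟩
  · rw [continuousOn_iff_continuous_domRestrict]
    exact (continuous_subtype_val.comp (φ.symm.continuous.comp
      (continuous_id.prodMk continuous_const))).congr fun p => (hs p).symm
  · rw [hs ⟨p, hp⟩, ← hφ, φ.apply_symm_apply]

/-- A bundle with a global section is trivial. -/
theorem exists_homeomorph_of_section [CompactSpace Q] [T2Space Q] {s : Q → P.Total}
    (hs : Continuous s) (hps : ∀ q, P.proj (s q) = q) :
    ∃ e : Q × Torus m ≃ₜ P.Total, ∀ a, e a = a.2 • s a.1 := by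
  have := P.t2Space
  have hbij : Function.Bijective fun a : Q × Torus m => a.2 • s a.1 := by
    constructor
    · rintro ⟨q, t⟩ ⟨q', t'⟩ h
      have hq := congrArg P.proj h
      simp only [P.proj_smul, hps] at hq
      subst hq
      have h1 := P.eq_one_of_smul_eq (s q) (t'⁻¹ * t) (by
        rw [mul_smul]; exact inv_smul_eq_iff.2 h)
      rw [inv_mul_eq_one.1 h1]
    · intro x
      obtain ⟨t, ht⟩ := P.exists_smul_eq (s (P.proj x)) x (hps _)
      exact ⟨(P.proj x, t), ht⟩
  exact ⟨Continuous.homeoOfEquivCompactToT2 (f := Equiv.ofBijective _ hbij)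
    (continuous_snd.smul (hs.comp continuous_fst)), fun a => rfl⟩

end PrincipalTorusBundle

/-! ### Comparison of the models -/

/-- A global section of a principal bundle identifies the product model with the canonical model:
over a point of a stratum, both are the quotient of the torus by the same subtorus. -/
theorem equivariantlyHomeomorphic_canonicalModel {d m : ℕ} {Q : Type u} [TopologicalSpace Q]
    [CompactSpace Q] [T2Space Q] {F : ℤ → Set Q} (lam : CharacteristicFunctor d m F)
    (P : PrincipalTorusBundle.{u, v} m Q) {s : Q → P.Total}
    (hs : Continuous s) (hps : ∀ q, P.proj (s q) = q) :
    EquivariantlyHomeomorphic m (ProductModel lam) (CanonicalModel lam P) := by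
  obtain ⟨e, he⟩ := P.exists_homeomorph_of_section hs hps
  have hproj : ∀ a, P.proj (e a) = a.1 := fun a => by rw [he, P.proj_smul, hps]
  have hrel : ∀ a b, ProductModel.setoid lam a b ↔ CanonicalModel.setoid lam P (e a) (e b) := by
    rintro ⟨q, t⟩ ⟨q', t'⟩
    change (q = q' ∧ ∀ S : Stratum F, q ∈ S.carrier → t⁻¹ * t' ∈ lam.subtorusAt S) ↔
      (P.proj (e (q, t)) = P.proj (e (q', t')) ∧ ∀ S : Stratum F, P.proj (e (q, t)) ∈ S.carrier →
        ∃ r ∈ lam.subtorusAt S, r • e (q, t) = e (q', t'))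
    rw [hproj, hproj]
    refine and_congr_right ?_
    rintro rfl
    refine forall₂_congr fun S _ => ?_
    have hr : ∀ r : Torus m, r • e (q, t) = e (q, t') ↔ r = t⁻¹ * t' := by
      intro r
      have : r • e (q, t) = e (q, r * t) := by rw [he, he, mul_smul]
      rw [this, e.injective.eq_iff, Prod.mk.injEq, eq_inv_mul_iff_mul_eq, mul_comm t r]
      simp
    constructor
    · exact fun h => ⟨_, h, (hr _).2 rfl⟩
    · rintro ⟨r, hrS, h⟩
      rwa [← (hr r).1 h]
  let E : ProductModel lam ≃ CanonicalModel lam P := Quotient.congr e.toEquiv hrel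
  refine ⟨⟨E, ?_, ?_⟩, ?_⟩
  · exact Continuous.quotient_map' (s := ProductModel.setoid lam) (t := CanonicalModel.setoid lam P)
      e.continuous fun a b => (hrel a b).1
  · exact Continuous.quotient_map' (s := CanonicalModel.setoid lam P) (t := ProductModel.setoid lam)
      e.symm.continuous fun a b h => (hrel _ _).2 (by
        rwa [e.apply_symm_apply, e.apply_symm_apply])
  · rintro t ⟨a⟩
    refine congrArg (Quotient.mk (CanonicalModel.setoid lam P)) ?_
    change e (a.1, t * a.2) = t • e a
    rw [he, he, mul_smul]

/-- A global section of the orbit projection identifies `X` with the product model. -/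
theorem IsLocallyStandardOverGraph.equivariantlyHomeomorphic_productModel {m : ℕ} {X : Type u}
    [TopologicalSpace X] [MulAction (Torus m) X] (hX : IsLocallyStandardOverGraph m X)
    {lam : CharacteristicFunctor (0 + 1) m (orbitSpaceFiltration 0 1 m X)}
    (hlam : IsCharacteristicFunctorOf 0 1 m X lam) {s : OrbitSpace m X → X} (hs : Continuous s)
    (hps : ∀ q, orbitProj m (s q) = q) :
    EquivariantlyHomeomorphic m X (ProductModel lam) := by
  have := hX.continuousSMul
  have := hX.compactSpace
  have := hX.t2Space
  have hrel : ∀ a b : OrbitSpace m X × Torus m,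
      ProductModel.setoid lam a b ↔ a.2 • s a.1 = b.2 • s b.1 := by
    rintro ⟨q, t⟩ ⟨q', t'⟩
    change (q = q' ∧ ∀ S : Stratum (orbitSpaceFiltration 0 1 m X), q ∈ S.carrier →
      t⁻¹ * t' ∈ lam.subtorusAt S) ↔ t • s q = t' • s q'
    have hstab : ∀ S : Stratum (orbitSpaceFiltration 0 1 m X), q ∈ S.carrier →
        (t⁻¹ * t' ∈ lam.subtorusAt S ↔ t • s q = t' • s q) := by
      intro S hS
      rw [hlam (s q) S (by rwa [hps]), MulAction.mem_stabilizer_iff, mul_smul, inv_smul_eq_iff,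
        eq_comm]
    constructor
    · rintro ⟨rfl, h⟩
      obtain ⟨S, hS⟩ := exists_stratum (m := m) (s q)
      rw [hps] at hS
      exact (hstab S hS).1 (h S hS)
    · intro h
      have hq := congrArg (orbitProj m) h
      rw [orbitProj_smul, orbitProj_smul, hps, hps] at hq
      subst hq
      exact ⟨rfl, fun S hS => (hstab S hS).2 h⟩
  have : CompactSpace (ProductModel lam) :=
    inferInstanceAs (CompactSpace (Quotient (ProductModel.setoid lam)))
  let f : ProductModel lam → X :=
    Quotient.lift (s := ProductModel.setoid lam) (fun a => a.2 • s a.1) fun a b => (hrel a b).1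
  have hf : Continuous f :=
    Continuous.quotient_lift (continuous_snd.smul (hs.comp continuous_fst)) _
  have hbij : Function.Bijective f := by
    constructor
    · rintro ⟨a⟩ ⟨b⟩ h
      exact Quotient.sound (s := ProductModel.setoid lam) ((hrel a b).2 h)
    · intro x
      obtain ⟨t, ht⟩ := (orbitProj_eq_iff (m := m)).1 (hps (orbitProj m x))
      exact ⟨Quotient.mk (ProductModel.setoid lam) (orbitProj m x, t), ht⟩
  let E := Continuous.homeoOfEquivCompactToT2 (f := Equiv.ofBijective f hbij) hf
  have hE : ∀ (t : Torus m) (a : ProductModel lam), E (t • a) = t • E a := by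
    rintro t ⟨a⟩
    exact mul_smul t a.2 (s a.1)
  refine ⟨E.symm, fun t x => E.injective ?_⟩
  rw [hE, E.apply_symm_apply, E.apply_symm_apply]

theorem mainTheorem6 (m : ℕ) (X : Type u) [TopologicalSpace X] [MulAction (Torus m) X]
    (hX : IsLocallyStandardOverGraph m X) :
    (∃ lam : CharacteristicFunctor (0 + 1) m (orbitSpaceFiltration 0 1 m X),
      IsCharacteristicFunctorOf 0 1 m X lam) ∧
    ∀ lam : CharacteristicFunctor (0 + 1) m (orbitSpaceFiltration 0 1 m X),
      IsCharacteristicFunctorOf 0 1 m X lam →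
        EquivariantlyHomeomorphic m X (ProductModel lam) ∧
        ∀ P : PrincipalTorusBundle.{u, v} m (OrbitSpace m X),
          EquivariantlyHomeomorphic m (ProductModel lam) (CanonicalModel lam P) := by
  have := hX.continuousSMul
  have := hX.compactSpace
  have := hX.t2Space
  have := t2Space_orbitSpace (m := m) (X := X)
  have hne : Nonempty X := hX.1.toNonempty
  have harc : ∀ q ∉ singularOrbits m X,
      ∃ e : OpenPartialHomeomorph (OrbitSpace m X) ℝ, q ∈ e.source :=
    fun q hq => hX.exists_openPartialHomeomorph hq
  refine ⟨hX.exists_characteristicFunctor, fun lam hlam => ⟨?_, fun P => ?_⟩⟩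
  · obtain ⟨s, hs, hps⟩ := exists_section_of_local (p := orbitProj m (X := X)) orbitProj_smul
      (fun x y => orbitProj_eq_iff.1) hX.exists_isSectionOn hX.finite_singularOrbits
      (fun x hx t ht => by
        rw [orbitProj_mem_singularOrbits_iff, not_not] at hx
        exact Subgroup.mem_bot.1 (hx ▸ MulAction.mem_stabilizer_iff.2 ht)) harc
    exact hX.equivariantlyHomeomorphic_productModel hlam hs hps
  · have := P.t2Space
    have : Nonempty P.Total := by
      obtain ⟨-, -, s, -⟩ := P.exists_isSectionOn (orbitProj m hne.some)
      exact ⟨s (orbitProj m hne.some)⟩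
    obtain ⟨s, hs, hps⟩ := exists_section_of_local P.proj_smul P.exists_smul_eq
      P.exists_isSectionOn hX.finite_singularOrbits
      (fun x _ => P.eq_one_of_smul_eq x) harc
    exact equivariantlyHomeomorphic_canonicalModel lam P hs hps
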